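/- For a nonempty bounded set $A\subset\mathbb{R}^N$ and $\delta>0$ let $A_\delta=\{x\in\mathbb{R}^N: d(x,A)<\delta\}$ ($d$ the Euclidean distance), let $\zeta_A(s)=\int_{A_\delta}d(x,A)^{s-N}\,dx$ be the distance zeta function of $A$, and let $D(\zeta_A)=\inf\{\alpha\ge 0:\int_{A_\delta}d(x,A)^{\alpha-N}\,dx<\infty\}$ be its abscissa of convergence. A point $s_0$ of the critical line $\{\operatorname{Re}s=D(\zeta_A)\}$ is a removable singularity of $\zeta_A$ if, on some open disk about $s_0$, there is a holomorphic function agreeing with $\zeta_A$ on the part of the disk in $\{\operatorname{Re}s>D(\zeta_A)\}$; otherwise it is nonremovable. The set $A$ is called maximally hyperfractal if (for every $\delta>0$) every point of the critical line is a nonremovable singularity of $\zeta_A$. The box dimension $\dim_BA$ is the common value, if they coincide, of the upper and lower box dimensions $\inf\{r>0:\limsup_{t\to0^+}|A_t|/t^{N-r}=0\}$ and $\inf\{r>0:\liminf_{t\to0^+}|A_t|/t^{N-r}=0\}$. Theorem. Let $N\ge 1$ be an integer and let $D\in(N-1,N)$. Then there is an explicitly constructible nonempty compact subset $A$ of $\mathbb{R}^N$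 that is maximally hyperfractal and whose box dimension exists and satisfies $\dim_BA=D$. Explicitly, one may take the following set. Put $d=D-(N-1)\in(0,1)$ and, for $k\ge1$, $m_k=k+1$, $a_k=m_k^{-1/d}$, $c_k=2^{-k}$. Consider the numbers $$c_k\,a_k^{\,n}\,\frac{1-m_ka_k}{m_k-1}\qquad(k\ge1,\ n\ge0),$$ the one with indices $(k,n)$ being repeated $(m_k-1)m_k^{\,n}$ times (for fixed $k$ these are the lengths of the holes of $c_kC^{(m_k,a_k)}$, where the generalized Cantor set $C^{(m,a)}\subset[0,1]$ is obtained by repeatedly replacing each interval by $m$ equidistant closed subintervals, scaled by the factor $a$, that include both ends). Together, with multiplicities, they can be listed as a nonincreasing summable sequence $(\ell_j)_{j\ge1}$ of positive numbers, and $$A=\Big(\{0\}\cup\Big\{\sum_{j\ge k}\ell_j:\ k\ge1\Big\}\Big)\times[0,1]^{N-1}.$$ -/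

import Mathlib

open MeasureTheory Filter Topology

namespace FractalZeta

/-- Euclidean space of dimension `N`. -/
abbrev E (N : ℕ) := EuclideanSpace ℝ (Fin N)

/-! ### Minkowski contents and box dimension -/

/-- The quotient `|A_t| / t ^ (N - r)`, where `A_t` is the open `t`-neighbourhood of `A`. -/
noncomputable def tubeRatio {N : ℕ} (A : Set (E N)) (r t : ℝ) : ENNReal :=
  volume (Metric.thickening t A) / ENNReal.ofReal (t ^ ((N : ℝ) - r))

/-- The upper `r`-dimensional Minkowski content. -/
noncomputable def upperContent {N : ℕ} (A : Set (E N)) (r : ℝ) : ENNReal :=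
  limsup (fun t : ℝ => tubeRatio A r t) (𝓝[>] 0)

/-- The lower `r`-dimensional Minkowski content. -/
noncomputable def lowerContent {N : ℕ} (A : Set (E N)) (r : ℝ) : ENNReal :=
  liminf (fun t : ℝ => tubeRatio A r t) (𝓝[>] 0)

/-- The upper Minkowski (box) dimension of a bounded set. -/
noncomputable def upperBoxDim {N : ℕ} (A : Set (E N)) : ℝ :=
  sInf {r : ℝ | 0 < r ∧ upperContent A r = 0}

/-- The lower Minkowski (box) dimension of a bounded set. -/
noncomputable def lowerBoxDim {N : ℕ} (A : Set (E N)) : ℝ :=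
  sInf {r : ℝ | 0 < r ∧ lowerContent A r = 0}

/-- The box dimension of `A` exists and equals `D`. -/
def HasBoxDim {N : ℕ} (A : Set (E N)) (D : ℝ) : Prop :=
  upperBoxDim A = D ∧ lowerBoxDim A = D

/-! ### The distance zeta function -/

/-- The distance zeta function `ζ_A(s) = ∫_{A_δ} d(x, A) ^ (s - N) dx`. -/
noncomputable def distanceZeta {N : ℕ} (A : Set (E N)) (δ : ℝ) (s : ℂ) : ℂ :=
  ∫ x in Metric.thickening δ A, ((Metric.infDist x A : ℝ) : ℂ) ^ (s - (N : ℂ))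

/-- The abscissa of (absolute) convergence
`D(ζ_A) = inf {α ≥ 0 : ∫_{A_δ} d(x, A) ^ (α - N) dx < ∞}`. The integrand is taken in `[0, ∞]`,
so that it is `∞` where the distance vanishes and `α < N`. -/
noncomputable def abscissa {N : ℕ} (A : Set (E N)) (δ : ℝ) : ℝ :=
  sInf {α : ℝ | 0 ≤ α ∧
    ∫⁻ x in Metric.thickening δ A,
      (ENNReal.ofReal (Metric.infDist x A)) ^ (α - (N : ℝ)) < ⊤}

/-- A function `f`, considered on the half-plane `{Re s > σ}`, has at most a removable singularity
at `s₀` if on some open disk about `s₀` there is a holomorphic function that agrees with `f` on the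
part of the disk in that half-plane. -/
def IsRemovableAt (f : ℂ → ℂ) (σ : ℝ) (s₀ : ℂ) : Prop :=
  ∃ ρ : ℝ, 0 < ρ ∧ ∃ g : ℂ → ℂ, DifferentiableOn ℂ g (Metric.ball s₀ ρ) ∧
    ∀ s ∈ Metric.ball s₀ ρ, σ < s.re → g s = f s

/-- `A` is maximally hyperfractal: every point of the critical line `{Re s = D(ζ_A)}` is a
nonremovable singularity of the distance zeta function (for each radius `δ > 0`). -/
def IsMaximallyHyperfractal {N : ℕ} (A : Set (E N)) : Prop :=
  ∀ δ : ℝ, 0 < δ → ∀ s₀ : ℂ, s₀.re = abscissa A δ →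
    ¬ IsRemovableAt (distanceZeta A δ) (abscissa A δ) s₀

/-! ### Fractal strings and the explicit construction -/

/-- A bounded fractal string: a nonincreasing summable sequence of positive reals. -/
def IsBoundedFractalString (L : ℕ → ℝ) : Prop :=
  (∀ j, 0 < L j) ∧ Antitone L ∧ Summable L

/-- `L` is a listing, with multiplicities, of the family `lam`. -/
def Lists {ι : Type} (L : ℕ → ℝ) (lam : ι → ℝ) : Prop :=
  ∃ e : ℕ ≃ ι, ∀ j, L j = lam (e j)

/-- The lengths of the holes of the generalized Cantor set `C^(m,a) ⊆ [0,1]`: at step `n` of the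
construction (`n = 0, 1, …`), each of the `m ^ n` intervals of length `a ^ n` acquires `m - 1`
holes of length `a ^ n * (1 - m a) / (m - 1)`. -/
noncomputable def cantorHole (m : ℕ) (a : ℝ)
    (i : Σ n : ℕ, Fin ((m - 1) * m ^ n)) : ℝ :=
  a ^ i.1 * ((1 - (m : ℝ) * a) / ((m : ℝ) - 1))

/-- The disjoint union, over `k = 0, 1, …`, of the strings of hole lengths of the scaled generalized
Cantor sets `c_k C^(m_k,a_k)`, where `m_k = k + 2`, `a_k = m_k ^ (-1/d)` and `c_k = 2 ^ (-(k+1))`. -/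
noncomputable def cantorUnion (d : ℝ)
    (i : Σ k : ℕ, Σ n : ℕ, Fin ((k + 2 - 1) * (k + 2) ^ n)) : ℝ :=
  (1 / 2 : ℝ) ^ (i.1 + 1) *
    cantorHole (i.1 + 2) (((i.1 + 2 : ℕ) : ℝ) ^ (-1 / d)) i.2

/-- The compact subset of the line associated with a fractal string: the tail sums
`∑_{j ≥ k} L j`, together with their limit `0`. -/
def stringSet (L : ℕ → ℝ) : Set ℝ :=
  insert 0 (Set.range fun k : ℕ => ∑' j : ℕ, L (k + j))

/-- The fractal grill `B × [0,1] ^ (N-1)` in `ℝ ^ N`, for `N ≥ 1` and `B ⊆ ℝ`. -/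
def grill (N : ℕ) (B : Set ℝ) : Set (E N) :=
  {x | ∀ i : Fin N, (i.val = 0 → x i ∈ B) ∧ (i.val ≠ 0 → x i ∈ Set.Icc (0 : ℝ) 1)}

end FractalZeta

/-!
Write `N = n + 1` and `d = D - n`, let `B = stringSet L` be the set of tail sums of the Cantor string
and `A = B × [0,1] ^ n`.

*From the grill to the string.* On the slab `ℝ × [0,1] ^ n` the distance to `A` is the distance of
the first coordinate to `B`, and inside a gap of `B` of length `ℓ` the integral of its power
`u - 1` is `2 (ℓ / 2) ^ u / u`. So the part of `ζ_A (n + u)` over the convex hull of `A` is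
`2 / (2 ^ u u) ∑ ℓ_j ^ u` (`integral_grillHull_infDist_cpow`). The rest of the integral converges
absolutely even at `u = d`: beyond a face of the cube the distance dominates both the distance of the
first coordinate to `B` and that of another coordinate to `[0,1]`, and the exponent `d - 1` can be
shared between the two (`lintegral_infDist_grill_beyond_face_lt_top`). Hence `ζ_A` and the hull
integral differ by a bounded function (`exists_norm_distanceZeta_sub_integral_grillHull_le`), which
is all that is needed; the remainder need not be continued holomorphically.

*Poles.* Summing geometric series gives
`∑ ℓ_j ^ u = ∑_k (m_k - 1) g_k ^ u / (1 - m_k ^ (1 - u / d))`, where `g_k` is the length of the largest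
holes of the `k`-th scaled Cantor set. The `k`-th term has poles at `d + iω` with
`ω log m_k ∈ 2πdℤ`, and dominated convergence gives the limit of `(σ - d) ∑ ℓ_j ^ (σ + iω)` as
`σ → d⁺` as the sum of the residues of the individual terms (`tendsto_sub_mul_zeta`). Poles of
different terms may coincide, so cancellation has to be excluded: if `m_k = p` is prime and
`ω = 2πdl / log p` with `l ≠ 0`, the other terms with a pole there belong to higher powers of `p`,
and since `g_k` decays like `2 ^ (-k)` the term of `p` dominates for large `p`. As the spacing
`2πd / log p` tends to `0`, genuine poles are dense in the critical line
(`exists_height_tsum_termResidue_ne_zero`). So `ζ_A` is unbounded near a dense set of points of the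
line, which excludes both a removable singularity and a smaller abscissa.

*Box dimension.* Convergence of the zeta integral at every exponent above `D` bounds `|A_t|` from
above by Chebyshev's inequality; a lower bound `|A_t| ≥ |B_t| ≥ c t ^ (1 - d)` comes from the gaps
of a single generation of the first Cantor set, those of length comparable to `t`.
-/

namespace FractalZeta

/-! ### The line: gaps of the set of tail sums -/

/-- The tail sums `∑_{j ≥ k} L j`. Together with `0` they form `stringSet L`, and the
intervals between consecutive tail sums are the gaps of that set. -/
noncomputable def tailSum (L : ℕ → ℝ) (k : ℕ) : ℝ := ∑' j : ℕ, L (k + j)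

theorem tailSum_eq_add_succ {L : ℕ → ℝ} (hL : Summable L) (k : ℕ) :
    tailSum L k = L k + tailSum L (k + 1) := by
  have hs : Summable fun j => L (k + j) := by
    simpa [add_comm] using (summable_nat_add_iff k).2 hL
  unfold tailSum
  rw [hs.tsum_eq_zero_add]
  simp only [add_zero]
  congr 2
  ext j
  congr 1
  ring

theorem tailSum_tendsto (L : ℕ → ℝ) : Tendsto (tailSum L) atTop (𝓝 0) := by
  have := tendsto_sum_nat_add L
  unfold tailSum
  simpa [add_comm] using this

theorem tailSum_strictAnti {L : ℕ → ℝ} (hL : IsBoundedFractalString L) :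
    StrictAnti (tailSum L) :=
  strictAnti_nat_of_succ_lt fun k => by
    have := hL.1 k
    rw [tailSum_eq_add_succ hL.2.2 k]; linarith

theorem tailSum_pos {L : ℕ → ℝ} (hL : IsBoundedFractalString L) (k : ℕ) : 0 < tailSum L k :=
  ((tailSum_strictAnti hL).antitone.le_of_tendsto (tailSum_tendsto L) (k + 1)).trans_lt
    (tailSum_strictAnti hL (Nat.lt_succ_self k))

theorem iUnion_Ioc_tailSum {L : ℕ → ℝ} (hL : IsBoundedFractalString L) :
    ⋃ k, Set.Ioc (tailSum L (k + 1)) (tailSum L k) = Set.Ioc 0 (tailSum L 0) := by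
  ext y
  simp only [Set.mem_iUnion, Set.mem_Ioc]
  constructor
  · rintro ⟨k, h1, h2⟩
    exact ⟨(tailSum_pos hL _).trans h1, h2.trans ((tailSum_strictAnti hL).antitone k.zero_le)⟩
  · rintro ⟨h0, hT⟩
    have hex : ∃ k, tailSum L k < y := ((tailSum_tendsto L).eventually_lt_const h0).exists
    classical
    have h1 := Nat.find_spec hex
    have h2 : Nat.find hex ≠ 0 := fun h => by rw [h] at h1; linarith
    obtain ⟨k, hk⟩ := Nat.exists_eq_succ_of_ne_zero h2
    refine ⟨k, by rwa [hk] at h1, not_lt.1 (Nat.find_min hex (by omega))⟩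

theorem pairwise_disjoint_Ioc_tailSum {L : ℕ → ℝ} (hL : IsBoundedFractalString L) :
    Pairwise (Function.onFun Disjoint fun k => Set.Ioc (tailSum L (k + 1)) (tailSum L k)) := by
  simpa using (tailSum_strictAnti hL).antitone.pairwise_disjoint_on_Ioc_succ

theorem zero_mem_stringSet (L : ℕ → ℝ) : (0 : ℝ) ∈ stringSet L := Set.mem_insert _ _

theorem tailSum_mem_stringSet (L : ℕ → ℝ) (k : ℕ) : tailSum L k ∈ stringSet L :=
  Set.mem_insert_of_mem _ ⟨k, rfl⟩

theorem stringSet_subset_Icc {L : ℕ → ℝ} (hL : IsBoundedFractalString L) :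
    stringSet L ⊆ Set.Icc 0 (tailSum L 0) := by
  rintro _ (rfl | ⟨k, rfl⟩)
  · exact ⟨le_rfl, (tailSum_pos hL 0).le⟩
  · exact ⟨(tailSum_pos hL k).le, (tailSum_strictAnti hL).antitone k.zero_le⟩

theorem isCompact_stringSet (L : ℕ → ℝ) : IsCompact (stringSet L) :=
  (tailSum_tendsto L).isCompact_insert_range

theorem countable_stringSet (L : ℕ → ℝ) : (stringSet L).Countable :=
  (Set.countable_range _).insert _

/-- Inside a gap the nearest point of the set is an endpoint of the gap. -/
theorem infDist_stringSet_of_mem_gap {L : ℕ → ℝ} (hL : IsBoundedFractalString L) {k : ℕ} {y : ℝ}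
    (hy : y ∈ Set.Icc (tailSum L (k + 1)) (tailSum L k)) :
    Metric.infDist y (stringSet L) = min (y - tailSum L (k + 1)) (tailSum L k - y) := by
  apply le_antisymm
  · apply le_min
    · refine (Metric.infDist_le_dist_of_mem (tailSum_mem_stringSet L (k + 1))).trans_eq ?_
      rw [Real.dist_eq, abs_of_nonneg (by linarith [hy.1])]
    · refine (Metric.infDist_le_dist_of_mem (tailSum_mem_stringSet L k)).trans_eq ?_
      rw [Real.dist_eq, abs_of_nonpos (by linarith [hy.2])]; ring
  · refine (Metric.le_infDist ⟨0, zero_mem_stringSet L⟩).2 fun b hb => ?_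
    rw [Real.dist_eq]
    rcases hb with rfl | ⟨j, rfl⟩
    · refine (min_le_left _ _).trans ((?_ : _ ≤ y - 0).trans (le_abs_self _))
      linarith [tailSum_pos hL (k + 1)]
    · rcases le_or_gt j k with hj | hj
      · refine (min_le_right _ _).trans ((?_ : _ ≤ -(y - tailSum L j)).trans (neg_le_abs _))
        linarith [(tailSum_strictAnti hL).antitone hj]
      · refine (min_le_left _ _).trans ((?_ : _ ≤ y - tailSum L j).trans (le_abs_self _))
        linarith [(tailSum_strictAnti hL).antitone (Nat.succ_le_of_lt hj)]

/-! ### Integrals over a gap and beyond the ends -/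

section Gap

variable {F : Type*} [NormedAddCommGroup F] [NormedSpace ℝ F]

theorem intervalIntegral_comp_min_sub {f : ℝ → F} {a b : ℝ} (hab : a ≤ b)
    (hf : IntervalIntegrable f volume 0 ((b - a) / 2)) :
    IntervalIntegrable (fun y => f (min (y - a) (b - y))) volume a b ∧
      ∫ y in a..b, f (min (y - a) (b - y)) = (2 : ℝ) • ∫ t in (0 : ℝ)..((b - a) / 2), f t := by
  set c := (a + b) / 2 with hc
  have hac : a ≤ c := by linarith
  have hcb : c ≤ b := by linarith
  have e1 : Set.EqOn (fun y => f (y - a)) (fun y => f (min (y - a) (b - y))) (Set.uIcc a c) := by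
    intro y hy
    rw [Set.uIcc_of_le hac] at hy
    simp only
    rw [min_eq_left (by linarith [hy.2])]
  have e2 : Set.EqOn (fun y => f (b - y)) (fun y => f (min (y - a) (b - y))) (Set.uIcc c b) := by
    intro y hy
    rw [Set.uIcc_of_le hcb] at hy
    simp only
    rw [min_eq_right (by linarith [hy.1])]
  have i1 : IntervalIntegrable (fun y => f (y - a)) volume a c := by
    have := hf.comp_sub_right a
    convert this using 1 <;> ring
  have i2 : IntervalIntegrable (fun y => f (b - y)) volume c b := by
    have := (hf.comp_sub_left b).symm
    convert this using 1 <;> ring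
  have j1 := i1.congr (e1.mono Set.uIoc_subset_uIcc)
  have j2 := i2.congr (e2.mono Set.uIoc_subset_uIcc)
  refine ⟨j1.trans j2, ?_⟩
  rw [← intervalIntegral.integral_add_adjacent_intervals j1 j2,
    ← intervalIntegral.integral_congr e1, ← intervalIntegral.integral_congr e2,
    intervalIntegral.integral_comp_sub_right, intervalIntegral.integral_comp_sub_left, two_smul]
  have h1 : a - a = 0 := sub_self a
  have h2 : b - b = 0 := sub_self b
  have h3 : c - a = (b - a) / 2 := by rw [hc]; ring
  have h4 : b - c = (b - a) / 2 := by rw [hc]; ring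
  rw [h1, h2, h3, h4]

end Gap

theorem lintegral_ofReal_rpow_lt_top {δ e : ℝ} (hδ : 0 ≤ δ) (he : -1 < e) :
    ∫⁻ t in Set.Ioo 0 δ, ENNReal.ofReal t ^ e < ⊤ := by
  have h := (intervalIntegral.intervalIntegrable_rpow' (a := 0) (b := δ) he)
  rw [intervalIntegrable_iff_integrableOn_Ioo_of_le hδ] at h
  refine (setLIntegral_congr_fun measurableSet_Ioo fun t ht => ?_).trans_lt h.2
  rw [Real.enorm_of_nonneg (Real.rpow_nonneg ht.1.le _), ENNReal.ofReal_rpow_of_pos ht.1]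

theorem ennreal_rpow_anti {x y : ENNReal} {e : ℝ} (he : e ≤ 0) (hxy : x ≤ y) : y ^ e ≤ x ^ e := by
  rw [← neg_neg e, ENNReal.rpow_neg y (-e), ENNReal.rpow_neg x (-e)]
  exact ENNReal.inv_le_inv.2 (ENNReal.rpow_le_rpow hxy (neg_nonneg.2 he))

/-- Outside an interval containing `S`, the distance to `S` is at least the distance to the
interval, so its powers with exponent above `-1` are integrable there. -/
theorem lintegral_infDist_rpow_diff_Icc_lt_top {S : Set ℝ} (hne : S.Nonempty) {p q : ℝ}
    (hS : S ⊆ Set.Icc p q) {δ e : ℝ} (hδ : 0 < δ) (he : -1 < e) (he0 : e ≤ 0) :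
    ∫⁻ x in Metric.thickening δ S \ Set.Icc p q,
      ENNReal.ofReal (Metric.infDist x S) ^ e < ⊤ := by
  have hsub : Metric.thickening δ S \ Set.Icc p q ⊆
      Set.Ioo (p - δ) p ∪ Set.Ioo q (q + δ) := by
    rintro x ⟨hx, hx'⟩
    obtain ⟨s, hs, hxs⟩ := Metric.mem_thickening_iff.1 hx
    rw [Real.dist_eq, abs_lt] at hxs
    have := hS hs
    rcases lt_or_ge x p with h | h
    · exact Or.inl ⟨by linarith [this.1], h⟩
    · have h2 : q < x := by by_contra hh; exact hx' ⟨h, not_lt.1 hh⟩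
      exact Or.inr ⟨h2, by linarith [this.2]⟩
  have mono : ∀ a b : ℝ, a ≤ b → ENNReal.ofReal b ^ e ≤ ENNReal.ofReal a ^ e := fun a b hab =>
    ennreal_rpow_anti he0 (ENNReal.ofReal_le_ofReal hab)
  refine (lintegral_mono_set hsub).trans_lt ((lintegral_union_le _ _ _).trans_lt
    (ENNReal.add_lt_top.2 ⟨?_, ?_⟩))
  · have h : ∫⁻ x in Set.Ioo (p - δ) p, ENNReal.ofReal (p - x) ^ e =
        ∫⁻ t in Set.Ioo 0 δ, ENNReal.ofReal t ^ e := by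
      have mp := (volume : Measure ℝ).measurePreserving_sub_left p
      rw [← mp.setLIntegral_comp_preimage measurableSet_Ioo (by fun_prop)]
      simp
    refine (setLIntegral_mono' measurableSet_Ioo fun x hx => mono _ _ ?_).trans_lt
      (h.trans_lt (lintegral_ofReal_rpow_lt_top hδ.le he))
    refine (Metric.le_infDist hne).2 fun s hs => ?_
    rw [Real.dist_eq]
    exact (by linarith [(hS hs).1] : p - x ≤ -(x - s)).trans (neg_le_abs _)
  · have h : ∫⁻ x in Set.Ioo q (q + δ), ENNReal.ofReal (x - q) ^ e =
        ∫⁻ t in Set.Ioo 0 δ, ENNReal.ofReal t ^ e := by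
      have mp := measurePreserving_sub_right (volume : Measure ℝ) q
      rw [← mp.setLIntegral_comp_preimage (s := Set.Ioo 0 δ) measurableSet_Ioo
        (f := fun t => ENNReal.ofReal t ^ e) (by fun_prop)]
      simp [add_comm]
    refine (setLIntegral_mono' measurableSet_Ioo fun x hx => mono _ _ ?_).trans_lt
      (h.trans_lt (lintegral_ofReal_rpow_lt_top hδ.le he))
    refine (Metric.le_infDist hne).2 fun s hs => ?_
    rw [Real.dist_eq]
    exact (by linarith [(hS hs).2] : x - q ≤ (x - s)).trans (le_abs_self _)

theorem lintegral_gap_rpow {L : ℕ → ℝ} (hL : IsBoundedFractalString L) (k : ℕ) {u : ℝ}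
    (hu : 0 < u) :
    ∫⁻ y in Set.Ioc (tailSum L (k + 1)) (tailSum L k),
        ENNReal.ofReal (Metric.infDist y (stringSet L)) ^ (u - 1) =
      ENNReal.ofReal (2 * ((L k / 2) ^ u / u)) := by
  have hlen : tailSum L k - tailSum L (k + 1) = L k := by
    rw [tailSum_eq_add_succ hL.2.2 k]; ring
  have hle : tailSum L (k + 1) ≤ tailSum L k := (tailSum_strictAnti hL).antitone k.le_succ
  obtain ⟨h1, h2⟩ := intervalIntegral_comp_min_sub hle
    (intervalIntegral.intervalIntegrable_rpow' (r := u - 1) (by linarith))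
  rw [integral_rpow (Or.inl (by linarith)), hlen, sub_add_cancel, Real.zero_rpow hu.ne', sub_zero,
    smul_eq_mul, intervalIntegral.integral_of_le hle] at h2
  rw [intervalIntegrable_iff_integrableOn_Ioc_of_le hle] at h1
  rw [← h2, ofReal_integral_eq_lintegral_ofReal h1]
  · rw [← restrict_Ioo_eq_restrict_Ioc]
    refine setLIntegral_congr_fun measurableSet_Ioo fun y hy => ?_
    rw [infDist_stringSet_of_mem_gap hL (Set.Ioo_subset_Icc_self hy), ENNReal.ofReal_rpow_of_pos]
    exact lt_min (by linarith [hy.1]) (by linarith [hy.2])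
  · refine (ae_restrict_iff' measurableSet_Ioc).2 (ae_of_all _ fun y hy => ?_)
    exact Real.rpow_nonneg (le_min (by linarith [hy.1]) (by linarith [hy.2])) _

theorem lintegral_Icc_infDist_rpow {L : ℕ → ℝ} (hL : IsBoundedFractalString L) {u : ℝ}
    (hu : 0 < u) :
    ∫⁻ y in Set.Icc 0 (tailSum L 0), ENNReal.ofReal (Metric.infDist y (stringSet L)) ^ (u - 1) =
      ∑' k, ENNReal.ofReal (2 * ((L k / 2) ^ u / u)) := by
  rw [← restrict_Ioc_eq_restrict_Icc, ← iUnion_Ioc_tailSum hL,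
    lintegral_iUnion (fun _ => measurableSet_Ioc) (pairwise_disjoint_Ioc_tailSum hL)]
  simp only [lintegral_gap_rpow hL _ hu]

theorem lintegral_Icc_infDist_rpow_lt_top {L : ℕ → ℝ} (hL : IsBoundedFractalString L) {u : ℝ}
    (hu : 0 < u) (hs : Summable fun k => L k ^ u) :
    ∫⁻ y in Set.Icc 0 (tailSum L 0), ENNReal.ofReal (Metric.infDist y (stringSet L)) ^ (u - 1)
      < ⊤ := by
  rw [lintegral_Icc_infDist_rpow hL hu]
  have : (fun k => 2 * ((L k / 2) ^ u / u)) = fun k => 2 / (2 ^ u * u) * L k ^ u := by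
    ext k
    rw [Real.div_rpow (hL.1 k).le zero_le_two]
    field_simp
  have hs' := hs.mul_left (2 / (2 ^ u * u))
  rw [← this] at hs'
  exact hs'.tsum_ofReal_lt_top

/-- For `Re w < 0` the bound also holds at `x = 0`, where the right side is infinite. -/
theorem enorm_ofReal_cpow_le {x : ℝ} (hx : 0 ≤ x) {w : ℂ} (hw : w.re < 0) :
    ‖(x : ℂ) ^ w‖ₑ ≤ ENNReal.ofReal x ^ w.re := by
  rcases hx.eq_or_lt with rfl | h
  · simp [ENNReal.zero_rpow_of_neg hw]
  · rw [← ofReal_norm, Complex.norm_cpow_eq_rpow_re_of_pos h,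
      ENNReal.ofReal_rpow_of_pos h]

/-- The string zeta function `∑ (L k) ^ u` governs the integral of a complex power of the distance
over the convex hull of the set of tail sums. -/
theorem integral_Icc_infDist_cpow {L : ℕ → ℝ} (hL : IsBoundedFractalString L) {u : ℂ}
    (hu : 0 < u.re) (hu1 : u.re < 1) (hs : Summable fun k => L k ^ u.re) :
    ∫ y in Set.Icc 0 (tailSum L 0), ((Metric.infDist y (stringSet L) : ℝ) : ℂ) ^ (u - 1) =
      2 / (2 ^ u * u) * ∑' k, (L k : ℂ) ^ u := by
  have hint : IntegrableOn (fun y => ((Metric.infDist y (stringSet L) : ℝ) : ℂ) ^ (u - 1))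
      (Set.Icc 0 (tailSum L 0)) := by
    refine ⟨Measurable.aestronglyMeasurable (by fun_prop), ?_⟩
    refine (lintegral_mono fun y => enorm_ofReal_cpow_le Metric.infDist_nonneg ?_).trans_lt
      (lintegral_Icc_infDist_rpow_lt_top hL hu hs)
    simpa using hu1
  have hu0 : u ≠ 0 := fun h => by simp [h] at hu
  rw [integral_Icc_eq_integral_Ioc, ← iUnion_Ioc_tailSum hL]
  have hint' := hint.mono_set Set.Ioc_subset_Icc_self
  rw [← iUnion_Ioc_tailSum hL] at hint'
  rw [← (hasSum_integral_iUnion (fun _ => measurableSet_Ioc)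
    (pairwise_disjoint_Ioc_tailSum hL) hint').tsum_eq, ← tsum_mul_left]
  congr 1
  ext k
  have hlen : tailSum L k - tailSum L (k + 1) = L k := by
    rw [tailSum_eq_add_succ hL.2.2 k]; ring
  have hle : tailSum L (k + 1) ≤ tailSum L k := (tailSum_strictAnti hL).antitone k.le_succ
  obtain ⟨-, h2⟩ := intervalIntegral_comp_min_sub hle
    (intervalIntegral.intervalIntegrable_cpow' (r := u - 1) (by simpa using hu))
  rw [integral_cpow (Or.inl (by simpa using hu)), hlen, sub_add_cancel, Complex.ofReal_zero,
    Complex.zero_cpow hu0, sub_zero, intervalIntegral.integral_of_le hle] at h2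
  have h3 : ((L k / 2 : ℝ) : ℂ) ^ u = (L k : ℂ) ^ u / 2 ^ u := by
    rw [← Complex.ofReal_ofNat, ← Complex.div_cpow_ofReal_nonneg (hL.1 k).le zero_le_two]
    push_cast; rfl
  have h4 : (2 : ℂ) ^ u ≠ 0 := by simp [Complex.cpow_eq_zero_iff]
  rw [setIntegral_congr_fun measurableSet_Ioc (fun y hy => by
    rw [infDist_stringSet_of_mem_gap hL (Set.Ioc_subset_Icc_self hy)]), h2, h3]
  simp only [Complex.real_smul, Complex.ofReal_ofNat]
  field_simp

/-! ### Nonincreasing listings and power sums of the Cantor string -/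

/-- A summable family of positive reals indexed by a countably infinite type has a nonincreasing
listing: the members preceding a given one (larger, or equal with a smaller code) are finitely
many, and counting them embeds the index type in `ℕ` compatibly with the order. -/
theorem exists_boundedFractalString_lists {ι : Type} [Countable ι] [Infinite ι] {lam : ι → ℝ}
    (hpos : ∀ i, 0 < lam i) (hs : Summable lam) :
    ∃ L : ℕ → ℝ, IsBoundedFractalString L ∧ Lists L lam := by
  classical
  obtain ⟨c, hc⟩ := exists_injective_nat ι
  let key : ι → ℝᵒᵈ ×ₗ ℕ := fun i => toLex (OrderDual.toDual (lam i), c i)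
  have hkey : Function.Injective key := fun i j h => hc (congrArg (fun x => (ofLex x).2) h)
  have hle : ∀ {i j}, key i ≤ key j → lam j ≤ lam i := by
    intro i j h
    rcases Prod.Lex.toLex_le_toLex.1 h with h | h
    · exact le_of_lt h
    · exact le_of_eq (congrArg OrderDual.ofDual h.1).symm
  have hfin : ∀ i, {j | key j < key i}.Finite := by
    intro i
    have h1 : {j | lam i ≤ lam j}.Finite := by
      have := hs.tendsto_cofinite_zero.eventually (gt_mem_nhds (hpos i))
      rw [eventually_cofinite] at this
      simpa using this
    exact h1.subset fun j hj => hle (le_of_lt hj)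
  let r : ι → ℕ := fun i => (hfin i).toFinset.card
  have hr : ∀ {i j}, key i < key j → r i < r j := by
    intro i j h
    apply Finset.card_lt_card
    rw [Finset.ssubset_iff_of_subset]
    · exact ⟨i, by simpa using h, by simp⟩
    · intro l hl
      simp only [Set.Finite.mem_toFinset, Set.mem_ofPred_eq] at hl ⊢
      exact hl.trans h
  have hri : Function.Injective r := fun i j h => by
    rcases lt_trichotomy (key i) (key j) with h' | h' | h'
    · exact absurd h (hr h').ne
    · exact hkey h'
    · exact absurd h (hr h').ne'
  have : Infinite (Set.range r) := (Set.infinite_range_of_injective hri).to_subtype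
  let o : ℕ ≃o Set.range r := Nat.Subtype.orderIsoOfNat (Set.range r)
  let e : ℕ ≃ ι := o.toEquiv.trans (Equiv.ofInjective r hri).symm
  have hre : ∀ n, r (e n) = o n := fun n =>
    congrArg Subtype.val ((Equiv.ofInjective r hri).apply_symm_apply (o n))
  refine ⟨fun n => lam (e n), ⟨fun n => hpos _, fun m n hmn => hle (not_lt.1 fun h => ?_),
    e.summable_iff.2 hs⟩, e, fun _ => rfl⟩
  have h1 := hr h
  rw [hre, hre] at h1
  exact absurd (o.monotone hmn) (not_le.2 h1)

/-- Index type of the Cantor string: the number `k` of the Cantor set, the generation `n` of the hole,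
and its number within the generation. -/
abbrev CantorIndex : Type := Σ k : ℕ, Σ n : ℕ, Fin ((k + 2 - 1) * (k + 2) ^ n)

instance (k : ℕ) : Infinite (Σ n : ℕ, Fin ((k + 2 - 1) * (k + 2) ^ n)) :=
  Infinite.of_injective (fun n => ⟨n, ⟨0, Nat.mul_pos (by omega) (by positivity)⟩⟩)
    fun a b h => by simpa using congrArg Sigma.fst h

/-- The length `c_k (1 - m_k a_k) / (m_k - 1)` of the largest holes of the `k`-th scaled Cantor set,
where `m_k = k + 2`. -/
noncomputable def firstGap (d : ℝ) (k : ℕ) : ℝ :=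
  (1 / 2 : ℝ) ^ (k + 1) * ((1 - ((k : ℝ) + 2) * ((k : ℝ) + 2) ^ (-1 / d)) / ((k : ℝ) + 1))

theorem cantorUnion_eq (d : ℝ) (i : CantorIndex) :
    cantorUnion d i = firstGap d i.1 * (((i.1 : ℝ) + 2) ^ (-1 / d)) ^ i.2.1 := by
  unfold cantorUnion cantorHole firstGap
  push_cast
  rw [show (i.1 : ℝ) + 2 - 1 = i.1 + 1 by ring]
  ring

theorem mul_ratio_eq {d : ℝ} (k : ℕ) :
    ((k : ℝ) + 2) * ((k : ℝ) + 2) ^ (-1 / d) = ((k : ℝ) + 2) ^ (1 - 1 / d) := by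
  rw [sub_eq_add_neg, Real.rpow_add (by positivity), Real.rpow_one, neg_div]

theorem rpow_one_sub_le {d σ : ℝ} (hd : 0 < d) (hσ : d ≤ σ) (k : ℕ) :
    ((k : ℝ) + 2) ^ (1 - σ / d) ≤ 2 ^ (1 - σ / d) :=
  Real.rpow_le_rpow_of_nonpos two_pos (by linarith [(Nat.cast_nonneg k : (0 : ℝ) ≤ k)])
    (by rw [sub_nonpos, le_div_iff₀ hd]; linarith)

theorem rpow_one_sub_lt_one {d σ : ℝ} (hd : 0 < d) (hσ : d < σ) : (2 : ℝ) ^ (1 - σ / d) < 1 :=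
  Real.rpow_lt_one_of_one_lt_of_neg one_lt_two (by rw [sub_neg, lt_div_iff₀ hd]; linarith)

theorem firstGap_ge {d : ℝ} (hd : d ∈ Set.Ioo (0 : ℝ) 1) (k : ℕ) :
    (1 / 2 : ℝ) ^ (k + 1) * ((1 - 2 ^ (1 - 1 / d)) / ((k : ℝ) + 1)) ≤ firstGap d k := by
  unfold firstGap
  rw [mul_ratio_eq]
  have := rpow_one_sub_le hd.1 hd.2.le k
  gcongr

theorem firstGap_pos {d : ℝ} (hd : d ∈ Set.Ioo (0 : ℝ) 1) (k : ℕ) : 0 < firstGap d k := by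
  refine lt_of_lt_of_le ?_ (firstGap_ge hd k)
  have := rpow_one_sub_lt_one hd.1 hd.2
  have : 0 < 1 - (2 : ℝ) ^ (1 - 1 / d) := by linarith
  positivity

theorem firstGap_le (d : ℝ) (k : ℕ) : firstGap d k ≤ (1 / 2 : ℝ) ^ (k + 1) := by
  unfold firstGap
  refine mul_le_of_le_one_right (by positivity) ?_
  rw [div_le_one (by positivity)]
  have : (0 : ℝ) ≤ ((k : ℝ) + 2) * ((k : ℝ) + 2) ^ (-1 / d) := by positivity
  linarith [(Nat.cast_nonneg k : (0 : ℝ) ≤ k)]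

theorem cantorUnion_pos {d : ℝ} (hd : d ∈ Set.Ioo (0 : ℝ) 1) (i : CantorIndex) :
    0 < cantorUnion d i := by
  rw [cantorUnion_eq]
  have := firstGap_pos hd i.1
  positivity

theorem ofReal_cpow_eq_exp {x : ℝ} (hx : 0 < x) (u : ℂ) :
    (x : ℂ) ^ u = Complex.exp (Real.log x * u) := by
  rw [Complex.cpow_def_of_ne_zero (by exact_mod_cast hx.ne'), ← Complex.ofReal_log hx.le]

theorem natCast_add_two_cpow (k : ℕ) (u : ℂ) :
    ((k : ℂ) + 2) ^ u = Complex.exp (Real.log ((k : ℝ) + 2) * u) := by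
  have := ofReal_cpow_eq_exp (x := (k : ℝ) + 2) (by positivity) u
  push_cast at this
  exact this

theorem norm_natCast_add_two_cpow (k : ℕ) (u : ℂ) :
    ‖((k : ℂ) + 2) ^ u‖ = ((k : ℝ) + 2) ^ u.re := by
  rw [← Complex.norm_cpow_eq_rpow_re_of_pos (by positivity)]
  push_cast
  rfl

theorem cantorUnion_cpow {d : ℝ} (hd : d ∈ Set.Ioo (0 : ℝ) 1) (i : CantorIndex) (u : ℂ) :
    (cantorUnion d i : ℂ) ^ u =
      (firstGap d i.1 : ℂ) ^ u * (((i.1 : ℂ) + 2) ^ (-u / d)) ^ i.2.1 := by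
  have hg := (firstGap_pos hd i.1).le
  have hm : (0 : ℝ) < (i.1 : ℝ) + 2 := by positivity
  rw [cantorUnion_eq, Complex.ofReal_mul, Complex.mul_cpow_ofReal_nonneg hg (by positivity),
    ofReal_cpow_eq_exp (x := (((i.1 : ℝ) + 2) ^ (-1 / d)) ^ i.2.1) (by positivity),
    natCast_add_two_cpow, ← Complex.exp_nat_mul, Real.log_pow, Real.log_rpow hm]
  congr 2
  push_cast
  ring

theorem cantorUnion_rpow {d : ℝ} (hd : d ∈ Set.Ioo (0 : ℝ) 1) (i : CantorIndex) (σ : ℝ) :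
    cantorUnion d i ^ σ =
      firstGap d i.1 ^ σ * (((i.1 : ℝ) + 2) ^ (-σ / d)) ^ i.2.1 := by
  have h := congrArg norm (cantorUnion_cpow hd i σ)
  rw [norm_mul, norm_pow, norm_natCast_add_two_cpow,
    Complex.norm_cpow_eq_rpow_re_of_pos (cantorUnion_pos hd i),
    Complex.norm_cpow_eq_rpow_re_of_pos (firstGap_pos hd _)] at h
  rw [← Complex.ofReal_neg, ← Complex.ofReal_div] at h
  simpa only [Complex.ofReal_re] using h

theorem half_pow_rpow (d : ℝ) (j : ℕ) : ((1 / 2 : ℝ) ^ j) ^ d = ((1 / 2 : ℝ) ^ d) ^ j := by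
  rw [← Real.rpow_natCast, ← Real.rpow_natCast, ← Real.rpow_mul (by norm_num),
    ← Real.rpow_mul (by norm_num), mul_comm]

theorem firstGap_rpow_le {d σ : ℝ} (hd : d ∈ Set.Ioo (0 : ℝ) 1) (hσ : d ≤ σ) (k : ℕ) :
    firstGap d k ^ σ ≤ ((1 / 2 : ℝ) ^ d) ^ (k + 1) := by
  have h0 := firstGap_pos hd k
  have h1 : firstGap d k ≤ 1 := (firstGap_le d k).trans (pow_le_one₀ (by norm_num) (by norm_num))
  calc firstGap d k ^ σ ≤ firstGap d k ^ d := Real.rpow_le_rpow_of_exponent_ge h0 h1 hσ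
    _ ≤ ((1 / 2 : ℝ) ^ (k + 1)) ^ d := Real.rpow_le_rpow h0.le (firstGap_le d k) hd.1.le
    _ = ((1 / 2 : ℝ) ^ d) ^ (k + 1) := half_pow_rpow d (k + 1)

theorem half_rpow_mem {d : ℝ} (hd : 0 < d) : (1 / 2 : ℝ) ^ d ∈ Set.Ioo (0 : ℝ) 1 :=
  ⟨by positivity, Real.rpow_lt_one (by norm_num) (by norm_num) hd⟩

theorem summable_succ_mul_pow {q : ℝ} (hq : q ∈ Set.Ioo (0 : ℝ) 1) :
    Summable fun k : ℕ => ((k : ℝ) + 1) * q ^ (k + 1) := by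
  have hn : ‖q‖ < 1 := by rw [Real.norm_of_nonneg hq.1.le]; exact hq.2
  have h : Summable fun n : ℕ => (n : ℝ) ^ 1 * q ^ n :=
    summable_pow_mul_geometric_of_norm_lt_one 1 hn
  have h' := (summable_nat_add_iff 1).2 h
  simpa using h'

/-- Summing over the equal holes of one generation of the `k`-th Cantor set. -/
theorem hasSum_fin_cantorUnion_cpow {d : ℝ} (hd : d ∈ Set.Ioo (0 : ℝ) 1) (k n : ℕ) (u : ℂ) :
    HasSum (fun j : Fin ((k + 2 - 1) * (k + 2) ^ n) => (cantorUnion d ⟨k, n, j⟩ : ℂ) ^ u)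
      (((k : ℂ) + 1) * (firstGap d k : ℂ) ^ u * (((k : ℂ) + 2) ^ (1 - u / d)) ^ n) := by
  have h := hasSum_fintype
    (fun j : Fin ((k + 2 - 1) * (k + 2) ^ n) => (cantorUnion d ⟨k, n, j⟩ : ℂ) ^ u)
  convert h using 1
  simp only [cantorUnion_cpow hd]
  have hm : ((k : ℂ) + 2) ≠ 0 := by exact_mod_cast (Nat.succ_ne_zero (k + 1))
  rw [Finset.sum_const, Finset.card_univ, Fintype.card_fin, nsmul_eq_mul, sub_eq_add_neg,
    Complex.cpow_add _ _ hm, Complex.cpow_one, neg_div]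
  push_cast [show k + 2 - 1 = k + 1 by omega]
  rw [mul_pow]
  ring

theorem norm_ratio_lt_one {d : ℝ} (hd : d ∈ Set.Ioo (0 : ℝ) 1) {u : ℂ} (hu : d < u.re) (k : ℕ) :
    ‖((k : ℂ) + 2) ^ (1 - u / d)‖ < 1 := by
  rw [norm_natCast_add_two_cpow]
  have : (1 - u / d).re = 1 - u.re / d := by simp
  rw [this]
  exact (rpow_one_sub_le hd.1 hu.le k).trans_lt (rpow_one_sub_lt_one hd.1 hu)

theorem hasSum_sigma_cantorUnion_cpow {d : ℝ} (hd : d ∈ Set.Ioo (0 : ℝ) 1) (k : ℕ) {u : ℂ}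
    (hu : d < u.re) :
    HasSum (fun n : ℕ => ((k : ℂ) + 1) * (firstGap d k : ℂ) ^ u *
        (((k : ℂ) + 2) ^ (1 - u / d)) ^ n)
      (((k : ℂ) + 1) * (firstGap d k : ℂ) ^ u / (1 - ((k : ℂ) + 2) ^ (1 - u / d))) :=
  (hasSum_geometric_of_norm_lt_one (norm_ratio_lt_one hd hu k)).mul_left _

theorem summable_cantorUnion_rpow {d σ : ℝ} (hd : d ∈ Set.Ioo (0 : ℝ) 1) (hσ : d < σ) :
    Summable fun i => cantorUnion d i ^ σ := by
  have hq := half_rpow_mem hd.1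
  have h1 := rpow_one_sub_lt_one hd.1 hσ
  have hg : ∀ k, 0 < firstGap d k ^ σ := fun k => Real.rpow_pos_of_pos (firstGap_pos hd k) σ
  have hfin : ∀ k n, HasSum
      (fun j : Fin ((k + 2 - 1) * (k + 2) ^ n) => cantorUnion d ⟨k, n, j⟩ ^ σ)
      (((k : ℝ) + 1) * firstGap d k ^ σ * (((k : ℝ) + 2) ^ (1 - σ / d)) ^ n) := by
    intro k n
    have h := hasSum_fintype
      (fun j : Fin ((k + 2 - 1) * (k + 2) ^ n) => cantorUnion d ⟨k, n, j⟩ ^ σ)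
    convert h using 1
    simp only [cantorUnion_rpow hd]
    rw [Finset.sum_const, Finset.card_univ, Fintype.card_fin, nsmul_eq_mul, sub_eq_add_neg,
      Real.rpow_add (by positivity), Real.rpow_one, neg_div]
    push_cast [show k + 2 - 1 = k + 1 by omega]
    rw [mul_pow]
    ring
  have hgeo : ∀ k : ℕ, HasSum (fun n : ℕ => ((k : ℝ) + 1) * firstGap d k ^ σ *
        (((k : ℝ) + 2) ^ (1 - σ / d)) ^ n)
      (((k : ℝ) + 1) * firstGap d k ^ σ * (1 - ((k : ℝ) + 2) ^ (1 - σ / d))⁻¹) := fun k =>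
    (hasSum_geometric_of_lt_one (by positivity)
      ((rpow_one_sub_le hd.1 hσ.le k).trans_lt h1)).mul_left _
  have hnn : ∀ i, 0 ≤ cantorUnion d i ^ σ := fun i => Real.rpow_nonneg (cantorUnion_pos hd i).le _
  have hin : ∀ k, HasSum (fun x : Σ n : ℕ, Fin ((k + 2 - 1) * (k + 2) ^ n) =>
      cantorUnion d ⟨k, x⟩ ^ σ)
      (((k : ℝ) + 1) * firstGap d k ^ σ * (1 - ((k : ℝ) + 2) ^ (1 - σ / d))⁻¹) := by
    intro k
    have hsum : Summable fun x : Σ n : ℕ, Fin ((k + 2 - 1) * (k + 2) ^ n) =>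
        cantorUnion d ⟨k, x⟩ ^ σ := by
      refine (summable_sigma_of_nonneg fun x => hnn _).2 ⟨fun n => (hfin k n).summable, ?_⟩
      simp only [(hfin k _).tsum_eq]
      exact (hgeo k).summable
    have h2 := hsum.hasSum.sigma (fun n => hfin k n)
    rw [← h2.unique (hgeo k)]
    exact hsum.hasSum
  refine (summable_sigma_of_nonneg hnn).2 ⟨fun k => (hin k).summable, ?_⟩
  simp only [(hin _).tsum_eq]
  refine Summable.of_nonneg_of_le (fun k => ?_) (fun k => ?_)
    ((summable_succ_mul_pow hq).mul_right (1 - (2 : ℝ) ^ (1 - σ / d))⁻¹)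
  · have := (rpow_one_sub_le hd.1 hσ.le k).trans_lt h1
    have := hg k
    have : 0 < 1 - ((k : ℝ) + 2) ^ (1 - σ / d) := by linarith
    positivity
  · have h3 := rpow_one_sub_le hd.1 hσ.le k
    have h4 := firstGap_rpow_le hd hσ.le k
    have := (hg k).le
    have h5 : 0 < 1 - (2 : ℝ) ^ (1 - σ / d) := by linarith
    have h6 : 0 ≤ (1 - ((k : ℝ) + 2) ^ (1 - σ / d))⁻¹ := inv_nonneg.2 (by linarith)
    gcongr

/-- The zeta function of the Cantor string is a sum of geometric series, one for each `k`, whose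
ratios `m_k a_k ^ u = m_k ^ (1 - u / d)` have modulus one on the critical line. -/
theorem tsum_cantorUnion_cpow {d : ℝ} (hd : d ∈ Set.Ioo (0 : ℝ) 1) {u : ℂ} (hu : d < u.re) :
    ∑' i, (cantorUnion d i : ℂ) ^ u =
      ∑' k : ℕ, ((k : ℂ) + 1) * (firstGap d k : ℂ) ^ u / (1 - ((k : ℂ) + 2) ^ (1 - u / d)) := by
  have hs : Summable fun i => (cantorUnion d i : ℂ) ^ u := by
    refine Summable.of_norm ?_
    simp only [Complex.norm_cpow_eq_rpow_re_of_pos (cantorUnion_pos hd _)]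
    exact summable_cantorUnion_rpow hd hu
  have h1 := fun k => (hs.sigma_factor k).hasSum
  have h2 : ∀ k, ∑' x : (Σ n : ℕ, Fin ((k + 2 - 1) * (k + 2) ^ n)), (cantorUnion d ⟨k, x⟩ : ℂ) ^ u =
      ((k : ℂ) + 1) * (firstGap d k : ℂ) ^ u / (1 - ((k : ℂ) + 2) ^ (1 - u / d)) := fun k =>
    ((h1 k).sigma fun n => hasSum_fin_cantorUnion_cpow hd k n u).unique
      (hasSum_sigma_cantorUnion_cpow hd k hu)
  rw [hs.tsum_sigma]
  exact tsum_congr h2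

theorem exists_string_lists_cantorUnion {d : ℝ} (hd : d ∈ Set.Ioo (0 : ℝ) 1) :
    ∃ L : ℕ → ℝ, IsBoundedFractalString L ∧ Lists L (cantorUnion d) :=
  exists_boundedFractalString_lists (cantorUnion_pos hd)
    (by simpa using summable_cantorUnion_rpow hd hd.2)

/-! ### Residues of the Cantor string zeta function on the critical line -/

/-- The point `d + iω` of the critical line is a pole of the `k`-th term of the zeta function: the
geometric ratio `m ^ (1 - u / d)`, with `m = k + 2`, equals `1` at `u = d + iω`. -/
def IsResonant (d ω : ℝ) (k : ℕ) : Prop :=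
  ((k : ℂ) + 2) ^ (-(ω * Complex.I) / (d : ℂ)) = 1

open Classical in
/-- The residue at `d + iω` of the `k`-th term of the zeta function. -/
noncomputable def termResidue (d ω : ℝ) (k : ℕ) : ℂ :=
  ((k : ℂ) + 1) * (firstGap d k : ℂ) ^ ((d : ℂ) + ω * Complex.I) *
    if IsResonant d ω k then (d : ℂ) / Real.log ((k : ℝ) + 2) else 0

theorem log_natCast_add_two_pos (k : ℕ) : 0 < Real.log ((k : ℝ) + 2) :=
  Real.log_pos (by linarith [(Nat.cast_nonneg k : (0 : ℝ) ≤ k)])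

theorem hasDerivAt_ratio {d : ℝ} (ω : ℝ) (k : ℕ) :
    HasDerivAt (fun σ : ℝ => ((k : ℂ) + 2) ^ (1 - ((σ : ℂ) + ω * Complex.I) / d))
      (((k : ℂ) + 2) ^ (1 - ((d : ℂ) + ω * Complex.I) / d) *
        (Real.log ((k : ℝ) + 2) * (-(1 / (d : ℂ))))) d := by
  simp only [natCast_add_two_cpow]
  refine HasDerivAt.cexp ?_
  refine HasDerivAt.const_mul _ ?_
  refine HasDerivAt.const_sub _ ?_
  refine HasDerivAt.div_const ?_ _
  exact (HasDerivAt.ofReal_comp (hasDerivAt_id d)).add_const _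

open Classical in
theorem tendsto_sub_div_one_sub_ratio {d : ℝ} (hd : 0 < d) (ω : ℝ) (k : ℕ) :
    Tendsto (fun σ : ℝ => ((σ : ℂ) - d) /
        (1 - ((k : ℂ) + 2) ^ (1 - ((σ : ℂ) + ω * Complex.I) / d))) (𝓝[>] d)
      (𝓝 (if IsResonant d ω k then (d : ℂ) / Real.log ((k : ℝ) + 2) else 0)) := by
  have hd' : (d : ℂ) ≠ 0 := by exact_mod_cast hd.ne'
  have hl : (Real.log ((k : ℝ) + 2) : ℂ) ≠ 0 := by
    exact_mod_cast (log_natCast_add_two_pos k).ne'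
  have hD := hasDerivAt_ratio (d := d) ω k
  have he : (1 - ((d : ℂ) + ω * Complex.I) / d) = -(ω * Complex.I) / (d : ℂ) := by
    field_simp; ring
  rw [he] at hD
  split_ifs with h
  · have hv := h
    unfold IsResonant at hv
    rw [hv, one_mul] at hD
    have h1 := hasDerivAt_iff_tendsto_slope.1 hD
    have h2 := (h1.mono_left (nhdsWithin_mono d fun x (hx : d < x) => hx.ne')).inv₀
      (mul_ne_zero hl (neg_ne_zero.2 (one_div_ne_zero hd')))
    have h3 := h2.neg
    have e : -(Real.log ((k : ℝ) + 2) * (-(1 / (d : ℂ))))⁻¹ = (d : ℂ) / Real.log ((k : ℝ) + 2) := by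
      field_simp
    rw [e] at h3
    refine h3.congr fun σ => ?_
    rw [slope_def_module, he, hv, Complex.real_smul, mul_inv, ← Complex.ofReal_inv, inv_inv,
      ← mul_neg, ← inv_neg, neg_sub, div_eq_mul_inv]
    push_cast
    rfl
  · have hc : Tendsto (fun σ : ℝ => 1 - ((k : ℂ) + 2) ^ (1 - ((σ : ℂ) + ω * Complex.I) / d))
        (𝓝[>] d) (𝓝 (1 - ((k : ℂ) + 2) ^ (-(ω * Complex.I) / (d : ℂ)))) := by
      have := (hD.continuousAt.tendsto.mono_left (nhdsWithin_le_nhds (s := Set.Ioi d))).const_sub 1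
      rwa [he] at this
    have hn : Tendsto (fun σ : ℝ => (σ : ℂ) - d) (𝓝[>] d) (𝓝 0) := by
      have : Tendsto (fun σ : ℝ => (σ : ℂ) - d) (𝓝 d) (𝓝 ((d : ℂ) - d)) :=
        (Complex.continuous_ofReal.sub continuous_const).tendsto d
      rw [sub_self] at this
      exact this.mono_left nhdsWithin_le_nhds
    have h2 := hn.div hc (sub_ne_zero.2 fun h' => h h'.symm)
    rw [zero_div] at h2
    exact h2

theorem norm_one_sub_ratio_ge {d : ℝ} (hd : 0 < d) {σ : ℝ} (hσ : d ≤ σ) (ω : ℝ) (k : ℕ) :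
    1 - (2 : ℝ) ^ (1 - σ / d) ≤ ‖1 - ((k : ℂ) + 2) ^ (1 - ((σ : ℂ) + ω * Complex.I) / d)‖ := by
  have h := norm_sub_norm_le (1 : ℂ) (((k : ℂ) + 2) ^ (1 - ((σ : ℂ) + ω * Complex.I) / d))
  rw [norm_one, norm_natCast_add_two_cpow] at h
  have e : (1 - ((σ : ℂ) + ω * Complex.I) / d).re = 1 - σ / d := by simp
  rw [e] at h
  linarith [rpow_one_sub_le hd hσ k]

/-- Residues may be computed term by term, by dominated convergence. -/
theorem tendsto_sub_mul_zeta {d : ℝ} (hd : d ∈ Set.Ioo (0 : ℝ) 1) (ω : ℝ) :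
    Tendsto (fun σ : ℝ => ((σ : ℂ) - d) *
        ∑' i, (cantorUnion d i : ℂ) ^ ((σ : ℂ) + ω * Complex.I)) (𝓝[>] d)
      (𝓝 (∑' k, termResidue d ω k)) := by
  have hq := half_rpow_mem hd.1
  have hlim : ∀ k : ℕ, Tendsto (fun σ : ℝ => ((k : ℂ) + 1) *
      (firstGap d k : ℂ) ^ ((σ : ℂ) + ω * Complex.I) * (((σ : ℂ) - d) /
        (1 - ((k : ℂ) + 2) ^ (1 - ((σ : ℂ) + ω * Complex.I) / d)))) (𝓝[>] d)
      (𝓝 (termResidue d ω k)) := by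
    intro k
    refine Tendsto.mul ?_ (tendsto_sub_div_one_sub_ratio hd.1 ω k)
    refine Tendsto.mono_left (Continuous.tendsto ?_ d) nhdsWithin_le_nhds
    have h0 : (firstGap d k : ℂ) ≠ 0 := by exact_mod_cast (firstGap_pos hd k).ne'
    refine continuous_const.mul (Continuous.const_cpow (by fun_prop) (Or.inl h0))
  -- The case of the smallest ratio `2` at height `0` bounds all the others.
  obtain ⟨C, hC⟩ : ∃ C : ℝ, ∀ᶠ σ : ℝ in 𝓝[>] d, (σ - d) / (1 - (2 : ℝ) ^ (1 - σ / d)) ≤ C := by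
    have h := (tendsto_sub_div_one_sub_ratio hd.1 0 0).norm
    refine ⟨_, ((h.eventually_le_const (lt_add_one _)).and self_mem_nhdsWithin).mono
      fun σ hσ => le_trans (le_of_eq ?_) hσ.1⟩
    have hσ' : d < σ := hσ.2
    have hlt := rpow_one_sub_lt_one hd.1 hσ'
    have e : (((0 : ℕ) : ℂ) + 2) ^ (1 - ((σ : ℂ) + ((0 : ℝ) : ℂ) * Complex.I) / d) =
        (((2 : ℝ) ^ (1 - σ / d) : ℝ) : ℂ) := by
      rw [Complex.ofReal_cpow zero_le_two]
      push_cast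
      simp
    rw [e, ← Complex.ofReal_sub, ← Complex.ofReal_one, ← Complex.ofReal_sub,
      ← Complex.ofReal_div, Complex.norm_real, Real.norm_of_nonneg]
    exact div_nonneg (by linarith) (by linarith)
  have key := tendsto_tsum_of_dominated_convergence
    (bound := fun k : ℕ => ((k : ℝ) + 1) * ((1 / 2 : ℝ) ^ d) ^ (k + 1) * C)
    ((summable_succ_mul_pow hq).mul_right C) hlim ?_
  · refine key.congr' (eventually_mem_nhdsWithin.mono fun σ hσ => ?_)
    have hu : d < ((σ : ℂ) + ω * Complex.I).re := by simpa using hσ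
    beta_reduce
    rw [tsum_cantorUnion_cpow hd hu, ← tsum_mul_left]
    exact tsum_congr fun k => by ring
  · filter_upwards [hC, eventually_mem_nhdsWithin] with σ hσC hσ k
    have hσ' : d < σ := hσ
    have hlt := rpow_one_sub_lt_one hd.1 hσ'
    have e1 : ((σ : ℂ) + ω * Complex.I).re = σ := by simp
    have e2 : ‖(k : ℂ) + 1‖ = (k : ℝ) + 1 := by
      exact_mod_cast Complex.norm_natCast (k + 1)
    have e3 : ‖(σ : ℂ) - d‖ = σ - d := by
      rw [← Complex.ofReal_sub, Complex.norm_real, Real.norm_of_nonneg (by linarith)]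
    rw [norm_mul, norm_mul, norm_div, e2, e3,
      Complex.norm_cpow_eq_rpow_re_of_pos (firstGap_pos hd k), e1]
    refine mul_le_mul ?_ (le_trans ?_ hσC) ?_ (by positivity)
    · exact mul_le_mul_of_nonneg_left (firstGap_rpow_le hd hσ'.le k) (by positivity)
    · exact div_le_div_of_nonneg_left (by linarith) (by linarith)
        (norm_one_sub_ratio_ge hd.1 hσ'.le ω k)
    · exact div_nonneg (by linarith) (norm_nonneg _)

theorem isResonant_iff {d : ℝ} (hd : 0 < d) (ω : ℝ) (k : ℕ) :
    IsResonant d ω k ↔ ∃ l : ℤ, ω * Real.log ((k : ℝ) + 2) = 2 * Real.pi * d * l := by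
  unfold IsResonant
  have hd' : (d : ℂ) ≠ 0 := by exact_mod_cast hd.ne'
  rw [natCast_add_two_cpow, Complex.exp_eq_one_iff]
  have key : ∀ l : ℤ, ((Real.log ((k : ℝ) + 2) : ℂ) * (-(ω * Complex.I) / d) =
      l * (2 * Real.pi * Complex.I)) ↔
      ω * Real.log ((k : ℝ) + 2) = 2 * Real.pi * d * (-l : ℤ) := by
    intro l
    rw [← Complex.ofReal_inj]
    push_cast
    rw [mul_div_assoc', div_eq_iff hd']
    constructor
    · intro h
      apply mul_right_cancel₀ Complex.I_ne_zero
      linear_combination -h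
    · intro h
      linear_combination (-Complex.I) * h
  constructor
  · rintro ⟨l, hl⟩
    exact ⟨-l, (key l).1 hl⟩
  · rintro ⟨l, hl⟩
    exact ⟨-l, (key (-l)).2 (by simpa using hl)⟩

/-- At a pole of the term with `m = p` prime, off the real axis, the only other terms with a pole
are those for which `m` is a higher power of `p`. -/
theorem eq_or_sq_le_of_isResonant {d : ℝ} (hd : 0 < d) {p : ℕ} (hp : p.Prime) {n : ℤ} (hn : n ≠ 0)
    {ω : ℝ} (hω : ω * Real.log p = 2 * Real.pi * d * n) {k : ℕ} (hk : IsResonant d ω k) :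
    k + 2 = p ∨ p ^ 2 ≤ k + 2 := by
  obtain ⟨l, hl⟩ := (isResonant_iff hd ω k).1 hk
  have hlp : 0 < Real.log p := Real.log_pos (by exact_mod_cast hp.one_lt)
  have hlk := log_natCast_add_two_pos k
  have hpi : 2 * Real.pi * d ≠ 0 := by positivity
  have hω0 : ω ≠ 0 := by
    rintro rfl
    rw [zero_mul, eq_comm, mul_eq_zero] at hω
    exact hω.elim hpi (by exact_mod_cast hn)
  have h1 : (n : ℝ) * Real.log ((k : ℝ) + 2) = l * Real.log p := by
    apply mul_left_cancel₀ (mul_ne_zero hω0 hpi)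
    linear_combination (2 * Real.pi * d * n) * hl - (2 * Real.pi * d * l) * hω
  have h2 : (n.natAbs : ℝ) * Real.log ((k : ℝ) + 2) = l.natAbs * Real.log p := by
    have := congrArg abs h1
    rw [abs_mul, abs_mul, abs_of_pos hlk, abs_of_pos hlp] at this
    simpa [Nat.cast_natAbs] using this
  have h3 : (k + 2) ^ n.natAbs = p ^ l.natAbs := by
    have : Real.log (((k + 2) ^ n.natAbs : ℕ) : ℝ) = Real.log ((p ^ l.natAbs : ℕ) : ℝ) := by
      push_cast
      rw [Real.log_pow, Real.log_pow]
      exact h2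
    have hpp : (0 : ℝ) < p := by exact_mod_cast hp.pos
    exact_mod_cast Real.log_injOn_pos (Set.mem_Ioi.2 (by positivity))
      (Set.mem_Ioi.2 (by push_cast; positivity)) this
  have h4 : k + 2 ∣ p ^ l.natAbs := h3 ▸ dvd_pow_self _ (Int.natAbs_ne_zero.2 hn)
  obtain ⟨j, -, hj⟩ := (Nat.dvd_prime_pow hp).1 h4
  rcases j with _ | _ | j
  · simp at hj
  · left; simpa using hj
  · right
    rw [hj]
    exact Nat.pow_le_pow_right hp.pos (by omega)

theorem norm_termResidue_le {d : ℝ} (hd : d ∈ Set.Ioo (0 : ℝ) 1) (ω : ℝ) (k : ℕ) :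
    ‖termResidue d ω k‖ ≤ ((k : ℝ) + 1) * ((1 / 2 : ℝ) ^ d) ^ (k + 1) * (d / Real.log 2) := by
  have hl2 := Real.log_pos one_lt_two
  have hd0 := hd.1
  have e2 : ‖(k : ℂ) + 1‖ = (k : ℝ) + 1 := by
    exact_mod_cast Complex.norm_natCast (k + 1)
  have e1 : ((d : ℂ) + ω * Complex.I).re = d := by simp
  unfold termResidue
  rw [norm_mul, norm_mul, e2, Complex.norm_cpow_eq_rpow_re_of_pos (firstGap_pos hd k), e1]
  refine mul_le_mul ?_ ?_ (norm_nonneg _) (by positivity)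
  · exact mul_le_mul_of_nonneg_left (firstGap_rpow_le hd le_rfl k) (by positivity)
  · split_ifs
    · rw [norm_div, Complex.norm_real, Complex.norm_real, Real.norm_of_nonneg hd0.le,
        Real.norm_of_nonneg (log_natCast_add_two_pos k).le]
      refine div_le_div_of_nonneg_left hd0.le hl2 (Real.log_le_log two_pos ?_)
      linarith [(Nat.cast_nonneg k : (0 : ℝ) ≤ k)]
    · rw [norm_zero]; positivity

theorem norm_termResidue_ge {d : ℝ} (hd : d ∈ Set.Ioo (0 : ℝ) 1) {ω : ℝ} {k : ℕ}
    (hk : IsResonant d ω k) :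
    ((1 / 2 : ℝ) ^ d) ^ (k + 1) * (1 - (2 : ℝ) ^ (1 - 1 / d)) ^ d * (d / ((k : ℝ) + 2)) ≤
      ‖termResidue d ω k‖ := by
  have hd0 := hd.1
  have hγ : 0 < 1 - (2 : ℝ) ^ (1 - 1 / d) := by linarith [rpow_one_sub_lt_one hd.1 hd.2]
  have e2 : ‖(k : ℂ) + 1‖ = (k : ℝ) + 1 := by
    exact_mod_cast Complex.norm_natCast (k + 1)
  have e1 : ((d : ℂ) + ω * Complex.I).re = d := by simp
  have hlk := log_natCast_add_two_pos k
  unfold termResidue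
  rw [norm_mul, norm_mul, e2, Complex.norm_cpow_eq_rpow_re_of_pos (firstGap_pos hd k), e1,
    if_pos hk, norm_div, Complex.norm_real, Complex.norm_real, Real.norm_of_nonneg hd0.le,
    Real.norm_of_nonneg hlk.le]
  refine mul_le_mul ?_ ?_ (by positivity) (by have := firstGap_pos hd k; positivity)
  · have h1 : (((1 / 2 : ℝ) ^ (k + 1)) * ((1 - 2 ^ (1 - 1 / d)) / ((k : ℝ) + 1))) ^ d ≤
        firstGap d k ^ d :=
      Real.rpow_le_rpow (by positivity) (firstGap_ge hd k) hd0.le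
    have h2 := half_pow_rpow d (k + 1)
    rw [Real.mul_rpow (by positivity) (by positivity), Real.div_rpow hγ.le (by positivity), h2] at h1
    have h3 : ((k : ℝ) + 1) ^ d ≤ (k : ℝ) + 1 :=
      Real.rpow_le_self_of_one_le (by linarith [(Nat.cast_nonneg k : (0 : ℝ) ≤ k)]) hd.2.le
    have h4 : 0 < ((k : ℝ) + 1) ^ d := by positivity
    calc ((1 / 2 : ℝ) ^ d) ^ (k + 1) * (1 - (2 : ℝ) ^ (1 - 1 / d)) ^ d
        ≤ ((k : ℝ) + 1) * (((1 / 2 : ℝ) ^ d) ^ (k + 1) *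
          ((1 - (2 : ℝ) ^ (1 - 1 / d)) ^ d / ((k : ℝ) + 1) ^ d)) := by
          rw [← mul_div_assoc, mul_div_assoc', le_div_iff₀ h4, mul_comm]
          gcongr
      _ ≤ _ := by gcongr
  · exact div_le_div_of_nonneg_left hd0.le hlk
      ((Real.log_le_sub_one_of_pos (by positivity)).trans (by linarith))

/-- If the term with `m = p` prime and large has a pole at height `ω ≠ 0`, the total residue does
not vanish: the terms that share the pole have `m ≥ p ^ 2`, and the factor `2 ^ (-k d)` makes the
sum of their residues much smaller than that of the first. -/
theorem exists_forall_tsum_termResidue_ne_zero {d : ℝ} (hd : d ∈ Set.Ioo (0 : ℝ) 1) :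
    ∃ P : ℕ, ∀ p : ℕ, p.Prime → P ≤ p → ∀ n : ℤ, n ≠ 0 → ∀ ω : ℝ,
      ω * Real.log p = 2 * Real.pi * d * n → ∑' k, termResidue d ω k ≠ 0 := by
  have hd0 := hd.1
  have hl2 := Real.log_pos one_lt_two
  set q : ℝ := (1 / 2 : ℝ) ^ d with hqdef
  have hq : q ∈ Set.Ioo (0 : ℝ) 1 := half_rpow_mem hd.1
  -- Splitting `q = r ^ 2`, one factor `r` makes the tail summable and the other makes it small.
  set r : ℝ := (1 / 2 : ℝ) ^ (d / 2)
  have hr : r ∈ Set.Ioo (0 : ℝ) 1 := half_rpow_mem (half_pos hd.1)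
  have hrq : r ^ 2 = q := by
    rw [← Real.rpow_natCast, ← Real.rpow_mul (by norm_num), hqdef]
    congr 1
    push_cast
    ring
  set γ : ℝ := (1 - (2 : ℝ) ^ (1 - 1 / d)) ^ d
  have hγ : 0 < γ :=
    Real.rpow_pos_of_pos (by linarith [rpow_one_sub_lt_one hd.1 hd.2]) _
  set S : ℝ := ∑' k : ℕ, ((k : ℝ) + 1) * r ^ (k + 1)
  have hlim : Tendsto (fun k : ℕ => ((k : ℝ) + 2) * q ^ (k + 1) * S) atTop (𝓝 0) := by
    have h1 := (summable_succ_mul_pow hq).tendsto_atTop_zero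
    have h2 : Tendsto (fun k : ℕ => q ^ (k + 1)) atTop (𝓝 0) :=
      (tendsto_pow_atTop_nhds_zero_of_lt_one hq.1.le hq.2).comp (tendsto_add_atTop_nat 1)
    have h3 := (h1.add h2).mul_const S
    rw [add_zero, zero_mul] at h3
    exact h3.congr fun k => by ring
  obtain ⟨K, hK⟩ := eventually_atTop.1
    (hlim.eventually_lt_const (show (0 : ℝ) < γ * Real.log 2 by positivity))
  refine ⟨K + 3, fun p hp hPp n hn ω hω h0 => ?_⟩
  obtain ⟨k₀, rfl⟩ : ∃ k₀, p = k₀ + 2 := ⟨p - 2, by omega⟩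
  have hres : IsResonant d ω k₀ :=
    (isResonant_iff hd0 ω k₀).2 ⟨n, by rw [← hω]; push_cast; rfl⟩
  have hsum : Summable (termResidue d ω) :=
    Summable.of_norm_bounded ((summable_succ_mul_pow hq).mul_right (d / Real.log 2))
      (norm_termResidue_le hd ω)
  rw [hsum.tsum_eq_add_tsum_ite k₀] at h0
  have hbound : ∀ k, ‖if k = k₀ then 0 else termResidue d ω k‖ ≤
      ((k : ℝ) + 1) * r ^ (k + 1) * (q ^ (2 * (k₀ + 1)) * (d / Real.log 2)) := by
    intro k
    have hr0 := hr.1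
    have hq0 := hq.1
    split_ifs with hkk
    · rw [norm_zero]; positivity
    by_cases hkr : IsResonant d ω k
    · have hge : (k₀ + 2) ^ 2 ≤ k + 2 :=
        (eq_or_sq_le_of_isResonant hd0 hp hn hω hkr).resolve_left (by omega)
      -- This uses `p = k₀ + 2 ≥ 3`, so that `p ^ 2 - 1 ≥ 4 (p - 1)`.
      have hge' : 2 * (2 * (k₀ + 1)) ≤ k + 1 := by nlinarith
      refine (norm_termResidue_le hd ω k).trans ?_
      have h1 : q ^ (k + 1) ≤ r ^ (k + 1) * q ^ (2 * (k₀ + 1)) := by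
        rw [← hrq, ← pow_mul, ← pow_mul, two_mul (k + 1), pow_add]
        exact mul_le_mul_of_nonneg_left (pow_le_pow_of_le_one hr.1.le hr.2.le hge')
          (by positivity)
      calc _ ≤ ((k : ℝ) + 1) * (r ^ (k + 1) * q ^ (2 * (k₀ + 1))) * (d / Real.log 2) := by
            gcongr
        _ = _ := by ring
    · rw [termResidue, if_neg hkr, mul_zero, norm_zero]; positivity
  have htail := tsum_of_norm_bounded
    (((summable_succ_mul_pow hr).mul_right (q ^ (2 * (k₀ + 1)) * (d / Real.log 2))).hasSum) hbound
  rw [tsum_mul_right] at htail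
  have hmain := norm_termResidue_ge hd hres
  have hn2 : ‖termResidue d ω k₀‖ = ‖∑' k, if k = k₀ then 0 else termResidue d ω k‖ := by
    rw [eq_neg_of_add_eq_zero_left h0, norm_neg]
  have hfin := hK k₀ (by omega)
  have hq0 : 0 < q ^ (k₀ + 1) := pow_pos hq.1 _
  have hcontra : q ^ (k₀ + 1) * γ * (d / ((k₀ : ℝ) + 2)) ≤
      S * (q ^ (2 * (k₀ + 1)) * (d / Real.log 2)) := (hmain.trans_eq hn2).trans htail
  rw [two_mul, pow_add q (k₀ + 1) (k₀ + 1), mul_div_assoc', mul_div_assoc', mul_div_assoc',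
    div_le_div_iff₀ (by positivity) hl2] at hcontra
  have : q ^ (k₀ + 1) * d * (γ * Real.log 2) ≤
      q ^ (k₀ + 1) * d * (((k₀ : ℝ) + 2) * q ^ (k₀ + 1) * S) := by linarith
  exact absurd (le_of_mul_le_mul_left this (by positivity)) (not_le.2 hfin)

/-- Heights at which the zeta function of the Cantor string has a genuine pole are dense. -/
theorem exists_height_tsum_termResidue_ne_zero {d : ℝ} (hd : d ∈ Set.Ioo (0 : ℝ) 1) (ω₀ : ℝ) {ε : ℝ}
    (hε : 0 < ε) : ∃ ω, |ω - ω₀| < ε ∧ ∑' k, termResidue d ω k ≠ 0 := by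
  obtain ⟨P, hP⟩ := exists_forall_tsum_termResidue_ne_zero hd
  have hlog : Tendsto (fun n : ℕ => Real.log n) atTop atTop :=
    Real.tendsto_log_atTop.comp tendsto_natCast_atTop_atTop
  obtain ⟨Q, hQ⟩ := eventually_atTop.1 (hlog.eventually_gt_atTop (4 * Real.pi * d / ε))
  obtain ⟨p, hpge, hp⟩ := Nat.exists_infinite_primes (max P Q)
  have hlp : 0 < Real.log p := Real.log_pos (by exact_mod_cast hp.one_lt)
  have hd0 := hd.1
  set s : ℝ := 2 * Real.pi * d / Real.log p
  have hs : 0 < s := by positivity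
  have hs2 : 2 * s < ε := by
    have h1 := hQ p ((le_max_right _ _).trans hpge)
    rw [div_lt_iff₀ hε] at h1
    rw [mul_div_assoc', div_lt_iff₀ hlp]
    linarith
  have hsl : s * Real.log p = 2 * Real.pi * d := div_mul_cancel₀ _ hlp.ne'
  -- Of the two multiples of `s` following `ω₀` at least one is not zero.
  obtain ⟨n, hn, hn1⟩ : ∃ n : ℤ, n ≠ 0 ∧ |n * s - ω₀| ≤ 2 * s := by
    have hf1 := Int.floor_le (ω₀ / s)
    have hf2 := Int.lt_floor_add_one (ω₀ / s)
    rw [le_div_iff₀ hs] at hf1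
    rw [div_lt_iff₀ hs] at hf2
    by_cases h : ⌊ω₀ / s⌋ + 1 = 0
    · refine ⟨⌊ω₀ / s⌋ + 2, by omega, ?_⟩
      push_cast
      rw [abs_le]
      constructor <;> nlinarith
    · refine ⟨⌊ω₀ / s⌋ + 1, h, ?_⟩
      push_cast
      rw [abs_le]
      constructor <;> nlinarith
  exact ⟨n * s, hn1.trans_lt hs2, hP p hp ((le_max_left _ _).trans hpge) n hn _
    (by rw [mul_assoc, hsl, mul_comm])⟩

/-! ### Distances and integrals for the grill -/

/-- The slab `ℝ × [0,1] ^ n`, where the distance to a grill depends on the first coordinate only. -/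
def slab (n : ℕ) : Set (E (n + 1)) := {z | ∀ i : Fin (n + 1), i ≠ 0 → z i ∈ Set.Icc (0 : ℝ) 1}

theorem mem_grill_iff {n : ℕ} {B : Set ℝ} {z : E (n + 1)} :
    z ∈ grill (n + 1) B ↔ z 0 ∈ B ∧ z ∈ slab n := by
  constructor
  · intro h
    exact ⟨(h 0).1 rfl, fun i hi => (h i).2 fun h' => hi (Fin.ext h')⟩
  · rintro ⟨h0, h⟩ i
    exact ⟨fun hi => by rwa [show i = 0 from Fin.ext hi], fun hi => h i fun h' => hi (by simp [h'])⟩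

theorem grill_nonempty {n : ℕ} {B : Set ℝ} (hB : B.Nonempty) : (grill (n + 1) B).Nonempty := by
  obtain ⟨b, hb⟩ := hB
  refine ⟨EuclideanSpace.single 0 b, mem_grill_iff.2 ⟨by simpa using hb, fun i hi => ?_⟩⟩
  simp [hi]

theorem isCompact_grill {n : ℕ} {B : Set ℝ} (hB : IsCompact B) : IsCompact (grill (n + 1) B) := by
  have h : IsCompact (Set.univ.pi fun i : Fin (n + 1) => if i = 0 then B else Set.Icc (0 : ℝ) 1) :=
    isCompact_univ_pi fun i => by split_ifs; exacts [hB, isCompact_Icc]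
  have h2 := (EuclideanSpace.equiv (Fin (n + 1)) ℝ).toHomeomorph.isClosedEmbedding.isCompact_preimage h
  convert h2 using 1
  ext z
  simp only [mem_grill_iff, slab, Set.mem_preimage, Set.mem_univ_pi, Set.mem_ofPred_eq]
  constructor
  · rintro ⟨h0, h⟩ i
    split_ifs with hi
    · subst hi; exact h0
    · exact h i hi
  · intro h
    exact ⟨by simpa using h 0, fun i hi => by simpa [hi] using h i⟩

theorem measurableSet_slab (n : ℕ) : MeasurableSet (slab n) := by
  have : slab n = ⋂ i : Fin (n + 1), ⋂ _ : i ≠ 0, (fun z : E (n + 1) => z i) ⁻¹' Set.Icc 0 1 := by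
    ext z; simp [slab]
  rw [this]
  exact MeasurableSet.iInter fun i => MeasurableSet.iInter fun _ =>
    measurableSet_Icc.preimage (by fun_prop)

theorem infDist_coord_le {n : ℕ} {A : Set (E n)} (hA : A.Nonempty) {S : Set ℝ} {i : Fin n}
    (h : ∀ a ∈ A, a i ∈ S) (z : E n) : Metric.infDist (z i) S ≤ Metric.infDist z A := by
  refine (Metric.le_infDist hA).2 fun a ha => ?_
  refine (Metric.infDist_le_dist_of_mem (h a ha)).trans ?_
  rw [dist_eq_norm, dist_eq_norm]
  exact PiLp.norm_apply_le (z - a) i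

theorem infDist_grill_of_mem_slab {n : ℕ} {B : Set ℝ} (hB : IsCompact B) (hne : B.Nonempty)
    {z : E (n + 1)} (hz : z ∈ slab n) :
    Metric.infDist z (grill (n + 1) B) = Metric.infDist (z 0) B := by
  apply le_antisymm
  · obtain ⟨b, hb, hzb⟩ := hB.exists_infDist_eq_dist hne (z 0)
    have hmem : z + EuclideanSpace.single 0 (b - z 0) ∈ grill (n + 1) B := by
      refine mem_grill_iff.2 ⟨by simpa using hb, fun i hi => ?_⟩
      simpa [hi] using hz i hi
    refine (Metric.infDist_le_dist_of_mem hmem).trans_eq ?_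
    rw [hzb, dist_self_add_right, PiLp.norm_single, dist_comm, dist_eq_norm]
  · exact infDist_coord_le (grill_nonempty hne) (fun a ha => (mem_grill_iff.1 ha).1) z

/-- Integrals over the slab of functions of the first coordinate are integrals over the line. -/
theorem measurePreserving_slab (n : ℕ) :
    MeasurePreserving (fun z : E (n + 1) => z 0) (volume.restrict (slab n)) volume := by
  refine ⟨by fun_prop, Measure.ext fun S hS => ?_⟩
  have hm : Measurable fun z : E (n + 1) => z 0 := by fun_prop
  rw [Measure.map_apply hm hS, Measure.restrict_apply (hS.preimage hm)]
  have h : (fun z : E (n + 1) => z 0) ⁻¹' S ∩ slab n =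
      WithLp.ofLp ⁻¹' (Set.univ.pi fun i : Fin (n + 1) => if i = 0 then S else Set.Icc (0 : ℝ) 1) := by
    ext z
    simp only [slab, Set.mem_inter_iff, Set.mem_preimage, Set.mem_univ_pi, Set.mem_ofPred_eq]
    constructor
    · rintro ⟨h0, h⟩ i
      split_ifs with hi
      · subst hi; exact h0
      · exact h i hi
    · intro h
      exact ⟨by simpa using h 0, fun i hi => by simpa [hi] using h i⟩
  rw [h, (PiLp.volume_preserving_ofLp (Fin (n + 1))).measure_preimage
    (MeasurableSet.univ_pi fun i => by split_ifs; exacts [hS, measurableSet_Icc]).nullMeasurableSet,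
    volume_pi_pi, Fin.prod_univ_succ]
  simp [Fin.succ_ne_zero]

theorem setLIntegral_slab {n : ℕ} {S : Set ℝ} (hS : MeasurableSet S) {f : ℝ → ENNReal}
    (hf : Measurable f) :
    ∫⁻ z in slab n ∩ (fun z => z 0) ⁻¹' S, f (z 0) = ∫⁻ x in S, f x := by
  rw [Set.inter_comm, ← Measure.restrict_restrict (hS.preimage (by fun_prop)),
    (measurePreserving_slab n).setLIntegral_comp_preimage hS hf]

theorem setIntegral_slab {n : ℕ} {S : Set ℝ} (hS : MeasurableSet S) {f : ℝ → ℂ}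
    (hf : Measurable f) :
    ∫ z in slab n ∩ (fun z => z 0) ⁻¹' S, f (z 0) = ∫ x in S, f x := by
  rw [Set.inter_comm, ← Measure.restrict_restrict (hS.preimage (by fun_prop))]
  have h := (measurePreserving_slab n).restrict_preimage hS
  rw [← h.map_eq, integral_map h.aemeasurable hf.aestronglyMeasurable]

theorem volume_slab {n : ℕ} {S : Set ℝ} (hS : MeasurableSet S) :
    volume (slab n ∩ (fun z => z 0) ⁻¹' S) = volume S := by
  have := setLIntegral_slab (n := n) hS (f := fun _ => 1) measurable_const
  simpa using this

/-! ### Powers of the distance -/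

theorem ennreal_rpow_le_add_one {x : ENNReal} {e e' : ℝ} (h : e ≤ e') (h0 : e' ≤ 0) :
    x ^ e' ≤ x ^ e + 1 := by
  rcases le_total x 1 with hx | hx
  · exact (ENNReal.rpow_le_rpow_of_exponent_ge hx h).trans le_self_add
  · exact ((ennreal_rpow_anti h0 hx).trans_eq (ENNReal.one_rpow _)).trans le_add_self

theorem setLIntegral_rpow_le {X : Type*} [MeasurableSpace X] {μ : Measure X} (W : Set X)
    (f : X → ENNReal) {e e' : ℝ} (h : e ≤ e') (h0 : e' ≤ 0) :
    ∫⁻ x in W, f x ^ e' ∂μ ≤ ∫⁻ x in W, f x ^ e ∂μ + μ W := by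
  refine (lintegral_mono fun x => ennreal_rpow_le_add_one h h0).trans ?_
  rw [lintegral_add_right _ measurable_const]
  simp

theorem integrable_indicator_infDist_rpow {S T : Set ℝ} (hT : MeasurableSet T) {e : ℝ} (he : e < 0)
    (h : ∫⁻ x in T, ENNReal.ofReal (Metric.infDist x S) ^ e < ⊤) :
    Integrable (T.indicator fun x => Metric.infDist x S ^ e) := by
  rw [integrable_indicator_iff hT]
  refine ⟨Measurable.aestronglyMeasurable (by fun_prop), (lintegral_mono fun x => ?_).trans_lt h⟩
  have h0 : 0 ≤ Metric.infDist x S := Metric.infDist_nonneg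
  rw [Real.enorm_of_nonneg (Real.rpow_nonneg h0 _)]
  rcases h0.eq_or_lt with h1 | h1
  · rw [← h1]; simp [ENNReal.zero_rpow_of_neg he]
  · rw [ENNReal.ofReal_rpow_of_pos h1]

/-- Away from the slab, beyond the face of the `i`-th coordinate, the distance dominates both the
distance of the first coordinate to `B` and that of the `i`-th coordinate to `[0,1]`. Splitting the
exponent evenly between them bounds the integral by a product of one-dimensional integrals. -/
theorem lintegral_infDist_grill_beyond_face_lt_top {n : ℕ} {B : Set ℝ} (hB : IsCompact B)
    (hne : B.Nonempty) (hnull : volume B = 0) {δ e : ℝ} (hδ : 0 < δ) (he : -1 < e) (he0 : e < 0)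
    (hfin : ∫⁻ x in Metric.thickening δ B, ENNReal.ofReal (Metric.infDist x B) ^ e < ⊤)
    {i : Fin (n + 1)} (hi : i ≠ 0) :
    ∫⁻ z in {z | z ∈ Metric.thickening δ (grill (n + 1) B) ∧ z i ∉ Set.Icc (0 : ℝ) 1},
      ENNReal.ofReal (Metric.infDist z (grill (n + 1) B)) ^ (2 * e) < ⊤ := by
  have hI : (Set.Icc (0 : ℝ) 1).Nonempty := ⟨0, by simp⟩
  have hA := grill_nonempty (n := n) hne
  let f : Fin (n + 1) → ℝ → ℝ := fun j =>
    if j = 0 then (Metric.thickening δ B).indicator fun x => Metric.infDist x B ^ e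
    else if j = i then (Metric.thickening δ (Set.Icc (0 : ℝ) 1) \ Set.Icc 0 1).indicator
      fun x => Metric.infDist x (Set.Icc (0 : ℝ) 1) ^ e
    else (Metric.thickening δ (Set.Icc (0 : ℝ) 1)).indicator fun _ => 1
  have hf : ∀ j, Integrable (f j) := by
    intro j
    simp only [f]
    split_ifs
    · exact integrable_indicator_infDist_rpow Metric.isOpen_thickening.measurableSet he0 hfin
    · exact integrable_indicator_infDist_rpow
        (Metric.isOpen_thickening.measurableSet.diff measurableSet_Icc) he0
        (lintegral_infDist_rpow_diff_Icc_lt_top hI subset_rfl hδ he he0.le)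
    · rw [integrable_indicator_iff Metric.isOpen_thickening.measurableSet]
      exact integrableOn_const
        ((Metric.isBounded_Icc 0 1).thickening.measure_lt_top).ne
  have hprod : Integrable (fun z : E (n + 1) => ∏ j, f j (z j)) :=
    (PiLp.volume_preserving_ofLp (Fin (n + 1))).integrable_comp_of_integrable
      (Integrable.fintype_prod hf)
  have hae : ∀ᵐ z : E (n + 1), z 0 ∉ B := by
    have h1 : ∀ᵐ w : Fin (n + 1) → ℝ, w 0 ∉ B :=
      (Measure.tendsto_eval_ae_ae (μ := fun _ : Fin (n + 1) => (volume : Measure ℝ))).eventually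
        (measure_eq_zero_iff_ae_notMem.1 hnull)
    exact (PiLp.volume_preserving_ofLp (Fin (n + 1))).quasiMeasurePreserving.tendsto_ae.eventually h1
  have hmeas : MeasurableSet
      {z : E (n + 1) | z ∈ Metric.thickening δ (grill (n + 1) B) ∧ z i ∉ Set.Icc (0 : ℝ) 1} :=
    Metric.isOpen_thickening.measurableSet.inter
      ((measurableSet_Icc.preimage (by fun_prop : Measurable fun z : E (n + 1) => z i)).compl)
  refine (setLIntegral_mono_ae' hmeas (hae.mono fun z hz0 hz => ?_)).trans_lt
    ((setLIntegral_le_lintegral _ _).trans_lt hprod.2)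
  obtain ⟨hzU, hzi⟩ := hz
  have hlt := (Metric.mem_thickening_iff_infDist_lt hA).1 hzU
  have h0 := infDist_coord_le hA (fun a ha => (mem_grill_iff.1 ha).1) z
  have hj : ∀ j, j ≠ 0 → Metric.infDist (z j) (Set.Icc 0 1) ≤
      Metric.infDist z (grill (n + 1) B) := fun j hj =>
    infDist_coord_le hA (fun a ha => (mem_grill_iff.1 ha).2 j hj) z
  have p0 : 0 < Metric.infDist (z 0) B :=
    (hB.isClosed.notMem_iff_infDist_pos hne).1 hz0
  have pi : 0 < Metric.infDist (z i) (Set.Icc 0 1) :=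
    (isClosed_Icc.notMem_iff_infDist_pos hI).1 hzi
  have f0 : f 0 (z 0) = Metric.infDist (z 0) B ^ e := by
    simp only [f, if_true]
    exact Set.indicator_of_mem ((Metric.mem_thickening_iff_infDist_lt hne).2 (h0.trans_lt hlt)) _
  have fi : f i (z i) = Metric.infDist (z i) (Set.Icc 0 1) ^ e := by
    simp only [f, if_true, if_neg hi]
    exact Set.indicator_of_mem (show z i ∈ _ \ _ from
      ⟨(Metric.mem_thickening_iff_infDist_lt hI).2 ((hj i hi).trans_lt hlt), hzi⟩) _
  have fj : ∀ j, j ≠ 0 ∧ j ≠ i → f j (z j) = 1 := by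
    rintro j ⟨h1, h2⟩
    simp only [f, if_neg h1, if_neg h2]
    exact Set.indicator_of_mem
      ((Metric.mem_thickening_iff_infDist_lt hI).2 ((hj j h1).trans_lt hlt)) _
  beta_reduce
  rw [Finset.prod_eq_mul (0 : Fin (n + 1)) i hi.symm (fun j _ h => fj j h) (by simp) (by simp),
    f0, fi, Real.enorm_of_nonneg (by positivity), ENNReal.ofReal_mul (by positivity),
    ← ENNReal.ofReal_rpow_of_pos p0, ← ENNReal.ofReal_rpow_of_pos pi, two_mul,
    ENNReal.rpow_add _ _ (by simpa using p0.trans_le h0) ENNReal.ofReal_ne_top]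
  exact mul_le_mul' (ennreal_rpow_anti he0.le (ENNReal.ofReal_le_ofReal h0))
    (ennreal_rpow_anti he0.le (ENNReal.ofReal_le_ofReal (hj i hi)))

theorem enorm_setIntegral_infDist_cpow_le {N : ℕ} (A W : Set (E N)) {e : ℝ} {w : ℂ} (h : e ≤ w.re)
    (h0 : w.re < 0) :
    ‖∫ z in W, ((Metric.infDist z A : ℝ) : ℂ) ^ w‖ₑ ≤
      (∫⁻ z in W, ENNReal.ofReal (Metric.infDist z A) ^ e) + volume W :=
  (enorm_integral_le_lintegral_enorm _).trans
    ((lintegral_mono fun _ => enorm_ofReal_cpow_le Metric.infDist_nonneg h0).trans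
      (setLIntegral_rpow_le (μ := volume) W (fun z => ENNReal.ofReal (Metric.infDist z A)) h h0.le))

theorem integrableOn_infDist_cpow {N : ℕ} {A W : Set (E N)} {w : ℂ} (h0 : w.re < 0)
    (h : ∫⁻ z in W, ENNReal.ofReal (Metric.infDist z A) ^ w.re < ⊤) :
    IntegrableOn (fun z => ((Metric.infDist z A : ℝ) : ℂ) ^ w) W :=
  ⟨Measurable.aestronglyMeasurable (by fun_prop),
    (lintegral_mono fun _ => enorm_ofReal_cpow_le Metric.infDist_nonneg h0).trans_lt h⟩

/-! ### Convergence of the distance zeta function -/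

section Lists

variable {d : ℝ} {L : ℕ → ℝ}

theorem summable_rpow_of_lists (hd : d ∈ Set.Ioo (0 : ℝ) 1) (hlist : Lists L (cantorUnion d))
    {σ : ℝ} (hσ : d < σ) : Summable fun j => L j ^ σ := by
  obtain ⟨e, he⟩ := hlist
  simp only [he]
  exact e.summable_iff.2 (summable_cantorUnion_rpow hd hσ)

theorem tsum_cpow_of_lists (hlist : Lists L (cantorUnion d)) (u : ℂ) :
    ∑' j, (L j : ℂ) ^ u = ∑' i, (cantorUnion d i : ℂ) ^ u := by
  obtain ⟨e, he⟩ := hlist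
  simp only [he]
  exact e.tsum_eq fun i => (cantorUnion d i : ℂ) ^ u

theorem lintegral_thickening_stringSet_lt_top (hd : d ∈ Set.Ioo (0 : ℝ) 1)
    (hL : IsBoundedFractalString L) (hlist : Lists L (cantorUnion d)) {δ : ℝ} (hδ : 0 < δ) {u : ℝ}
    (hu : u ∈ Set.Ioo d 1) :
    ∫⁻ x in Metric.thickening δ (stringSet L),
      ENNReal.ofReal (Metric.infDist x (stringSet L)) ^ (u - 1) < ⊤ := by
  have hu0 : 0 < u := hd.1.trans hu.1
  have hsub : Metric.thickening δ (stringSet L) ⊆ Set.Icc 0 (tailSum L 0) ∪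
      (Metric.thickening δ (stringSet L) \ Set.Icc 0 (tailSum L 0)) := by
    rw [Set.union_sdiff_self]; exact Set.subset_union_right
  refine (lintegral_mono_set hsub).trans_lt ((lintegral_union_le _ _ _).trans_lt
    (ENNReal.add_lt_top.2 ⟨?_, ?_⟩))
  · exact lintegral_Icc_infDist_rpow_lt_top hL hu0 (summable_rpow_of_lists hd hlist hu.1)
  · exact lintegral_infDist_rpow_diff_Icc_lt_top ⟨0, zero_mem_stringSet L⟩
      (stringSet_subset_Icc hL) hδ (by linarith) (by linarith [hu.2])

end Lists

/-- The convex hull of the grill of a string set. -/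
def grillHull (n : ℕ) (L : ℕ → ℝ) : Set (E (n + 1)) :=
  slab n ∩ (fun z => z 0) ⁻¹' Set.Icc 0 (tailSum L 0)

theorem measurableSet_grillHull (n : ℕ) (L : ℕ → ℝ) : MeasurableSet (grillHull n L) :=
  (measurableSet_slab n).inter (measurableSet_Icc.preimage (by fun_prop))

theorem volume_grillHull_lt_top (n : ℕ) (L : ℕ → ℝ) : volume (grillHull n L) < ⊤ := by
  rw [grillHull, volume_slab measurableSet_Icc]
  exact measure_Icc_lt_top

section Grill

variable {n : ℕ} {d : ℝ} {L : ℕ → ℝ}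

theorem infDist_grill_stringSet {z : E (n + 1)} (hz : z ∈ slab n) :
    Metric.infDist z (grill (n + 1) (stringSet L)) = Metric.infDist (z 0) (stringSet L) :=
  infDist_grill_of_mem_slab (isCompact_stringSet L) ⟨0, zero_mem_stringSet L⟩ hz

theorem grill_stringSet_nonempty (n : ℕ) (L : ℕ → ℝ) :
    (grill (n + 1) (stringSet L)).Nonempty := grill_nonempty ⟨0, zero_mem_stringSet L⟩

theorem mem_thickening_grill_iff {δ : ℝ} {z : E (n + 1)} (hz : z ∈ slab n) :
    z ∈ Metric.thickening δ (grill (n + 1) (stringSet L)) ↔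
      z 0 ∈ Metric.thickening δ (stringSet L) := by
  rw [Metric.mem_thickening_iff_infDist_lt (grill_stringSet_nonempty n L),
    Metric.mem_thickening_iff_infDist_lt ⟨0, zero_mem_stringSet L⟩, infDist_grill_stringSet hz]

theorem volume_thickening_grill_lt_top (δ : ℝ) :
    volume (Metric.thickening δ (grill (n + 1) (stringSet L))) < ⊤ :=
  ((isCompact_grill (isCompact_stringSet L)).isBounded.thickening).measure_lt_top

theorem setLIntegral_slab_infDist_grill {S : Set ℝ} (hS : MeasurableSet S) (e : ℝ) :
    ∫⁻ z in slab n ∩ (fun z => z 0) ⁻¹' S,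
        ENNReal.ofReal (Metric.infDist z (grill (n + 1) (stringSet L))) ^ e =
      ∫⁻ x in S, ENNReal.ofReal (Metric.infDist x (stringSet L)) ^ e := by
  rw [← setLIntegral_slab (n := n) hS (by fun_prop)]
  exact setLIntegral_congr_fun ((measurableSet_slab n).inter (hS.preimage (by fun_prop)))
    fun z hz => by rw [infDist_grill_stringSet hz.1]

/-- Off the hull, the distance zeta integral converges even at the abscissa. -/
theorem lintegral_thickening_diff_grillHull_lt_top (hd : d ∈ Set.Ioo (0 : ℝ) 1)
    (hL : IsBoundedFractalString L) (hlist : Lists L (cantorUnion d)) {δ : ℝ} (hδ : 0 < δ) :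
    ∫⁻ z in Metric.thickening δ (grill (n + 1) (stringSet L)) \ grillHull n L,
      ENNReal.ofReal (Metric.infDist z (grill (n + 1) (stringSet L))) ^ (d - 1) < ⊤ := by
  set A := grill (n + 1) (stringSet L)
  have hsub : Metric.thickening δ A \ grillHull n L ⊆
      (slab n ∩ (fun z => z 0) ⁻¹' (Metric.thickening δ (stringSet L) \ Set.Icc 0 (tailSum L 0))) ∪
      ⋃ i : {i : Fin (n + 1) // i ≠ 0}, {z | z ∈ Metric.thickening δ A ∧ z i ∉ Set.Icc (0 : ℝ) 1} := by
    rintro z ⟨hzU, hzG⟩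
    by_cases hz : z ∈ slab n
    · exact Or.inl ⟨hz, (mem_thickening_grill_iff hz).1 hzU, fun h => hzG ⟨hz, h⟩⟩
    · right
      simp only [slab, Set.mem_ofPred_eq, not_forall] at hz
      obtain ⟨i, hi, hzi⟩ := hz
      exact Set.mem_iUnion.2 ⟨⟨i, hi⟩, hzU, hzi⟩
  refine (lintegral_mono_set hsub).trans_lt ((lintegral_union_le _ _ _).trans_lt
    (ENNReal.add_lt_top.2 ⟨?_, ?_⟩))
  · rw [setLIntegral_slab_infDist_grill
      (Metric.isOpen_thickening.measurableSet.diff measurableSet_Icc)]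
    exact lintegral_infDist_rpow_diff_Icc_lt_top ⟨0, zero_mem_stringSet L⟩
      (stringSet_subset_Icc hL) hδ (by linarith [hd.1]) (by linarith [hd.2])
  · refine (lintegral_iUnion_le _ _).trans_lt ?_
    rw [tsum_fintype]
    refine ENNReal.sum_lt_top.2 fun i _ => ?_
    -- Half of the exponent `d - 1` is `u - 1` with `u = (1 + d) / 2 > d`.
    have h := lintegral_infDist_grill_beyond_face_lt_top (n := n) (e := (1 + d) / 2 - 1)
      (isCompact_stringSet L) ⟨0, zero_mem_stringSet L⟩ ((countable_stringSet L).measure_zero _) hδ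
      (by linarith [hd.1]) (by linarith [hd.2])
      (lintegral_thickening_stringSet_lt_top hd hL hlist hδ
        ⟨by linarith [hd.2], by linarith [hd.2]⟩) i.2
    rwa [show 2 * ((1 + d) / 2 - 1) = d - 1 by ring] at h

theorem lintegral_grillHull_lt_top (hd : d ∈ Set.Ioo (0 : ℝ) 1)
    (hL : IsBoundedFractalString L) (hlist : Lists L (cantorUnion d)) {u : ℝ} (hu : d < u) :
    ∫⁻ z in grillHull n L,
      ENNReal.ofReal (Metric.infDist z (grill (n + 1) (stringSet L))) ^ (u - 1) < ⊤ := by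
  rw [grillHull, setLIntegral_slab_infDist_grill measurableSet_Icc]
  exact lintegral_Icc_infDist_rpow_lt_top hL (hd.1.trans hu) (summable_rpow_of_lists hd hlist hu)

theorem lintegral_thickening_grill_lt_top (hd : d ∈ Set.Ioo (0 : ℝ) 1)
    (hL : IsBoundedFractalString L) (hlist : Lists L (cantorUnion d)) {δ : ℝ} (hδ : 0 < δ) {u : ℝ}
    (hu : u ∈ Set.Ioo d 1) :
    ∫⁻ z in Metric.thickening δ (grill (n + 1) (stringSet L)),
      ENNReal.ofReal (Metric.infDist z (grill (n + 1) (stringSet L))) ^ (u - 1) < ⊤ := by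
  set A := grill (n + 1) (stringSet L)
  have hsub : Metric.thickening δ A ⊆ grillHull n L ∪ (Metric.thickening δ A \ grillHull n L) := by
    rw [Set.union_sdiff_self]; exact Set.subset_union_right
  refine (lintegral_mono_set hsub).trans_lt ((lintegral_union_le _ _ _).trans_lt
    (ENNReal.add_lt_top.2 ⟨lintegral_grillHull_lt_top hd hL hlist hu.1, ?_⟩))
  refine (setLIntegral_rpow_le (μ := volume) _ (fun z => ENNReal.ofReal (Metric.infDist z A))
    (by linarith [hu.1] : d - 1 ≤ u - 1) (by linarith [hu.2])).trans_lt (ENNReal.add_lt_top.2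
      ⟨lintegral_thickening_diff_grillHull_lt_top hd hL hlist hδ, ?_⟩)
  exact (measure_mono Set.sdiff_subset).trans_lt (volume_thickening_grill_lt_top δ)

/-! ### Comparison with the string zeta function -/

theorem integral_grillHull_infDist_cpow (hd : d ∈ Set.Ioo (0 : ℝ) 1)
    (hL : IsBoundedFractalString L) (hlist : Lists L (cantorUnion d)) {u : ℂ}
    (hu : u.re ∈ Set.Ioo d 1) :
    ∫ z in grillHull n L,
        ((Metric.infDist z (grill (n + 1) (stringSet L)) : ℝ) : ℂ) ^ (u - 1) =
      2 / (2 ^ u * u) * ∑' i, (cantorUnion d i : ℂ) ^ u := by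
  rw [← tsum_cpow_of_lists hlist, ← integral_Icc_infDist_cpow hL (hd.1.trans hu.1) hu.2
    (summable_rpow_of_lists hd hlist hu.1), grillHull, ← setIntegral_slab (n := n) measurableSet_Icc
      (f := fun x => ((Metric.infDist x (stringSet L) : ℝ) : ℂ) ^ (u - 1)) (by fun_prop)]
  exact setIntegral_congr_fun (measurableSet_grillHull n L) fun z hz => by
    simp only
    rw [infDist_grill_stringSet hz.1]

/-- The distance zeta function differs from the integral over the hull of the grill by a bounded
function on the strip between the abscissa and `Re s = N`. -/
theorem exists_norm_distanceZeta_sub_integral_grillHull_le (n : ℕ) (hd : d ∈ Set.Ioo (0 : ℝ) 1)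
    (hL : IsBoundedFractalString L) (hlist : Lists L (cantorUnion d)) {δ : ℝ} (hδ : 0 < δ) :
    ∃ C : ℝ, ∀ u : ℂ, u.re ∈ Set.Ioo d 1 →
      ‖distanceZeta (grill (n + 1) (stringSet L)) δ (n + u) -
        ∫ z in grillHull n L,
          ((Metric.infDist z (grill (n + 1) (stringSet L)) : ℝ) : ℂ) ^ (u - 1)‖ ≤ C := by
  set A := grill (n + 1) (stringSet L) with hA
  set U := Metric.thickening δ A
  set G := grillHull n L
  have hU : MeasurableSet U := Metric.isOpen_thickening.measurableSet
  have hG : MeasurableSet G := measurableSet_grillHull n L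
  set I : Set (E (n + 1)) → ENNReal := fun W =>
    (∫⁻ z in W, ENNReal.ofReal (Metric.infDist z A) ^ (d - 1)) + volume W with hI
  have h1 : I (U \ G) < ⊤ := ENNReal.add_lt_top.2
    ⟨lintegral_thickening_diff_grillHull_lt_top hd hL hlist hδ,
      (measure_mono Set.sdiff_subset).trans_lt (volume_thickening_grill_lt_top δ)⟩
  have h2 : I (G \ U) < ⊤ := by
    have hv : volume (G \ U) < ⊤ :=
      (measure_mono Set.sdiff_subset).trans_lt (volume_grillHull_lt_top n L)
    refine ENNReal.add_lt_top.2 ⟨?_, hv⟩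
    refine (setLIntegral_mono' (hG.diff hU) (g := fun _ => ENNReal.ofReal δ ^ (d - 1))
      fun z hz => ennreal_rpow_anti (by linarith [hd.2])
        (ENNReal.ofReal_le_ofReal (not_lt.1 fun h => hz.2
          ((Metric.mem_thickening_iff_infDist_lt (grill_stringSet_nonempty n L)).2 h)))).trans_lt ?_
    rw [setLIntegral_const]
    exact ENNReal.mul_lt_top
      (ENNReal.rpow_ne_top_of_ne_zero (by simpa using hδ) ENNReal.ofReal_ne_top).lt_top hv
  refine ⟨(I (U \ G) + I (G \ U)).toReal, fun u hu => ?_⟩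
  have hre : (u - 1).re = u.re - 1 := by simp
  have hneg : (u - 1).re < 0 := by rw [hre]; linarith [hu.2]
  have hge : d - 1 ≤ (u - 1).re := by rw [hre]; linarith [hu.1]
  have hiU : IntegrableOn (fun z => ((Metric.infDist z A : ℝ) : ℂ) ^ (u - 1)) U :=
    integrableOn_infDist_cpow hneg
      (by rw [hre]; exact lintegral_thickening_grill_lt_top hd hL hlist hδ hu)
  have hiG : IntegrableOn (fun z => ((Metric.infDist z A : ℝ) : ℂ) ^ (u - 1)) G :=
    integrableOn_infDist_cpow hneg
      (by rw [hre]; exact lintegral_grillHull_lt_top hd hL hlist hu.1)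
  have hz : distanceZeta A δ (n + u) = ∫ z in U, ((Metric.infDist z A : ℝ) : ℂ) ^ (u - 1) := by
    unfold distanceZeta
    have : (n : ℂ) + u - ((n + 1 : ℕ) : ℂ) = u - 1 := by push_cast; ring
    rw [this]
  rw [hz, ← integral_inter_add_sdiff hG hiU, ← integral_inter_add_sdiff hU hiG, Set.inter_comm G U,
    add_sub_add_left_eq_sub, ← toReal_enorm]
  refine ENNReal.toReal_mono (ENNReal.add_lt_top.2 ⟨h1, h2⟩).ne ?_
  exact (enorm_sub_le).trans (add_le_add (enorm_setIntegral_infDist_cpow_le A _ hge hneg)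
    (enorm_setIntegral_infDist_cpow_le A _ hge hneg))

/-- Near a dense set of points of the critical line, the distance zeta function is unbounded. -/
theorem exists_height_distanceZeta_unbounded (n : ℕ) (hd : d ∈ Set.Ioo (0 : ℝ) 1)
    (hL : IsBoundedFractalString L) (hlist : Lists L (cantorUnion d)) {δ : ℝ} (hδ : 0 < δ)
    (ω₀ : ℝ) {ε : ℝ} (hε : 0 < ε) :
    ∃ ω : ℝ, |ω - ω₀| < ε ∧ ¬ ∃ C : ℝ, ∀ᶠ σ : ℝ in 𝓝[>] d,
      ‖distanceZeta (grill (n + 1) (stringSet L)) δ (n + ((σ : ℂ) + ω * Complex.I))‖ ≤ C := by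
  obtain ⟨ω, hω, hR⟩ := exists_height_tsum_termResidue_ne_zero hd ω₀ hε
  refine ⟨ω, hω, ?_⟩
  rintro ⟨C, hC⟩
  obtain ⟨C', hC'⟩ := exists_norm_distanceZeta_sub_integral_grillHull_le n hd hL hlist hδ
  set F : ℝ → ℂ := fun σ => ∫ z in grillHull n L,
    ((Metric.infDist z (grill (n + 1) (stringSet L)) : ℝ) : ℂ) ^ (((σ : ℂ) + ω * Complex.I) - 1)
  have hre : ∀ σ : ℝ, ((σ : ℂ) + ω * Complex.I).re = σ := by simp
  have hIoo : ∀ᶠ σ : ℝ in 𝓝[>] d, σ ∈ Set.Ioo d 1 := Ioo_mem_nhdsGT hd.2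
  have hu0 : (d : ℂ) + ω * Complex.I ≠ 0 := fun h => by
    have := congrArg Complex.re h
    rw [hre] at this
    exact hd.1.ne' this
  have h2 : (2 : ℂ) ^ ((d : ℂ) + ω * Complex.I) ≠ 0 := by simp [Complex.cpow_eq_zero_iff]
  have hlim : Tendsto (fun σ : ℝ => ((σ : ℂ) - d) * F σ) (𝓝[>] d)
      (𝓝 (2 / (2 ^ ((d : ℂ) + ω * Complex.I) * ((d : ℂ) + ω * Complex.I)) *
        ∑' k, termResidue d ω k)) := by
    have hc : Tendsto (fun σ : ℝ => (2 : ℂ) / (2 ^ ((σ : ℂ) + ω * Complex.I) *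
        ((σ : ℂ) + ω * Complex.I))) (𝓝[>] d)
        (𝓝 (2 / (2 ^ ((d : ℂ) + ω * Complex.I) * ((d : ℂ) + ω * Complex.I)))) := by
      have hcu : Continuous fun σ : ℝ => (σ : ℂ) + ω * Complex.I := by fun_prop
      have hcd : Continuous fun σ : ℝ => (2 : ℂ) ^ ((σ : ℂ) + ω * Complex.I) *
          ((σ : ℂ) + ω * Complex.I) :=
        (hcu.const_cpow (Or.inl two_ne_zero)).mul hcu
      exact (tendsto_const_nhds.div (hcd.tendsto d) (mul_ne_zero h2 hu0)).mono_left
        nhdsWithin_le_nhds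
    refine (hc.mul (tendsto_sub_mul_zeta hd ω)).congr' (hIoo.mono fun σ hσ => ?_)
    simp only [F]
    rw [integral_grillHull_infDist_cpow hd hL hlist (by rwa [hre])]
    ring
  have hzero : Tendsto (fun σ : ℝ => ((σ : ℂ) - d) * F σ) (𝓝[>] d) (𝓝 0) := by
    refine squeeze_zero_norm' (a := fun σ : ℝ => (σ - d) * (C + C')) ?_ ?_
    · filter_upwards [hC, hIoo] with σ hσ hσI
      have h3 := hC' ((σ : ℂ) + ω * Complex.I) (by rwa [hre])
      have hF : ‖F σ‖ ≤ C + C' := by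
        have := norm_sub_norm_le (F σ)
          (distanceZeta (grill (n + 1) (stringSet L)) δ (n + ((σ : ℂ) + ω * Complex.I)))
        rw [norm_sub_rev] at this
        linarith
      rw [norm_mul, ← Complex.ofReal_sub, Complex.norm_real,
        Real.norm_of_nonneg (by linarith [hσI.1])]
      exact mul_le_mul_of_nonneg_left hF (by linarith [hσI.1])
    · have : Tendsto (fun σ : ℝ => (σ - d) * (C + C')) (𝓝 d) (𝓝 ((d - d) * (C + C'))) :=
        Continuous.tendsto (by fun_prop) d
      rw [sub_self, zero_mul] at this
      exact this.mono_left nhdsWithin_le_nhds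
  exact mul_ne_zero (div_ne_zero two_ne_zero (mul_ne_zero h2 hu0)) hR
    (tendsto_nhds_unique hlim hzero)

theorem abscissa_grill_stringSet (n : ℕ) (hd : d ∈ Set.Ioo (0 : ℝ) 1)
    (hL : IsBoundedFractalString L) (hlist : Lists L (cantorUnion d)) {δ : ℝ} (hδ : 0 < δ) :
    abscissa (grill (n + 1) (stringSet L)) δ = n + d := by
  have hn : (0 : ℝ) ≤ n := Nat.cast_nonneg n
  have hfin : ∀ α ∈ Set.Ioo ((n : ℝ) + d) (n + 1), α ∈ {α : ℝ | 0 ≤ α ∧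
      ∫⁻ x in Metric.thickening δ (grill (n + 1) (stringSet L)),
        (ENNReal.ofReal (Metric.infDist x (grill (n + 1) (stringSet L)))) ^
          (α - ((n + 1 : ℕ) : ℝ)) < ⊤} := by
    intro α hα
    refine ⟨by linarith [hα.1, hd.1], ?_⟩
    have := lintegral_thickening_grill_lt_top (n := n) hd hL hlist hδ (u := α - n)
      ⟨by linarith [hα.1], by linarith [hα.2]⟩
    rwa [show α - n - 1 = α - ((n + 1 : ℕ) : ℝ) by push_cast; ring] at this
  refine csInf_eq_of_forall_ge_of_forall_gt_exists_lt
    ⟨n + (d + 1) / 2, hfin _ ⟨by linarith [hd.2], by linarith [hd.2]⟩⟩ ?_ ?_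
  · rintro α ⟨-, hα⟩
    by_contra! hlt
    -- Convergence at `α < D` gives convergence at `D`, hence a bound for the zeta function.
    obtain ⟨ω, -, hω⟩ := exists_height_distanceZeta_unbounded n hd hL hlist hδ 0 one_pos
    set A := grill (n + 1) (stringSet L)
    set K := (∫⁻ x in Metric.thickening δ A, (ENNReal.ofReal (Metric.infDist x A)) ^
      (α - ((n + 1 : ℕ) : ℝ))) + volume (Metric.thickening δ A)
    have hK : K < ⊤ := ENNReal.add_lt_top.2 ⟨hα, volume_thickening_grill_lt_top δ⟩
    refine hω ⟨K.toReal, ?_⟩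
    filter_upwards [Ioo_mem_nhdsGT hd.2] with σ hσ
    unfold distanceZeta
    rw [← toReal_enorm]
    have hre : ((n : ℂ) + ((σ : ℂ) + ω * Complex.I) - ((n + 1 : ℕ) : ℂ)).re = σ - 1 := by
      simp
    refine ENNReal.toReal_mono hK.ne (enorm_setIntegral_infDist_cpow_le A _ ?_ ?_)
    · rw [hre]; push_cast; linarith [hσ.1]
    · rw [hre]; linarith [hσ.2]
  · intro w hw
    obtain ⟨α, h1, h2⟩ := exists_between
      (lt_min hw (by linarith [hd.2] : (n : ℝ) + d < n + 1))
    exact ⟨α, hfin α ⟨h1, h2.trans_le (min_le_right _ _)⟩, h2.trans_le (min_le_left _ _)⟩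

theorem isMaximallyHyperfractal_grill_stringSet (n : ℕ) (hd : d ∈ Set.Ioo (0 : ℝ) 1)
    (hL : IsBoundedFractalString L) (hlist : Lists L (cantorUnion d)) :
    IsMaximallyHyperfractal (grill (n + 1) (stringSet L)) := by
  intro δ hδ s₀ hs₀
  rw [abscissa_grill_stringSet n hd hL hlist hδ] at hs₀ ⊢
  rintro ⟨ρ, hρ, g, hg, hgf⟩
  obtain ⟨ω, hω, hunb⟩ := exists_height_distanceZeta_unbounded n hd hL hlist hδ s₀.im hρ
  set s : ℝ → ℂ := fun σ => (n : ℂ) + ((σ : ℂ) + ω * Complex.I) with hs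
  have hsc : Continuous s := by fun_prop
  have hmem : s d ∈ Metric.ball s₀ ρ := by
    have : s d - s₀ = ((ω - s₀.im : ℝ) : ℂ) * Complex.I := by
      apply Complex.ext
      · simp [hs, hs₀]
      · simp [hs]
    rw [Metric.mem_ball, dist_eq_norm, this, norm_mul, Complex.norm_I, mul_one, Complex.norm_real]
    exact hω
  have hgc : Tendsto (fun σ => ‖g (s σ)‖) (𝓝[>] d) (𝓝 ‖g (s d)‖) :=
    (((hg.continuousOn.continuousAt (Metric.isOpen_ball.mem_nhds hmem)).tendsto.comp
      (hsc.tendsto d)).norm).mono_left nhdsWithin_le_nhds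
  refine hunb ⟨‖g (s d)‖ + 1, ?_⟩
  have hball : ∀ᶠ σ in 𝓝[>] d, s σ ∈ Metric.ball s₀ ρ :=
    (hsc.tendsto d).mono_left nhdsWithin_le_nhds (Metric.isOpen_ball.mem_nhds hmem)
  filter_upwards [hgc.eventually_le_const (lt_add_one _), hball, self_mem_nhdsWithin]
    with σ h1 h2 (h3 : d < σ)
  rw [← hgf (s σ) h2 (by simpa [hs] using h3)]
  exact h1

/-! ### Box dimension -/

/-- Counting the gaps of one generation of the first Cantor set that are shorter than `t`, but
comparable to `t`, bounds the length of the `t`-neighbourhood of the string set from below. -/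
theorem exists_le_volume_thickening_stringSet (hd : d ∈ Set.Ioo (0 : ℝ) 1)
    (hL : IsBoundedFractalString L) (hlist : Lists L (cantorUnion d)) :
    ∃ c : ℝ, 0 < c ∧ ∀ᶠ t : ℝ in 𝓝[>] 0,
      ENNReal.ofReal (c * t ^ (1 - d)) ≤ volume (Metric.thickening t (stringSet L)) := by
  obtain ⟨e, he⟩ := hlist
  have hd0 := hd.1
  set G := firstGap d 0 with hGdef
  have hG : 0 < G := firstGap_pos hd 0
  set a : ℝ := (2 : ℝ) ^ (-1 / d) with ha
  have ha0 : 0 < a := by positivity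
  have ha1 : a < 1 := Real.rpow_lt_one_of_one_lt_of_neg one_lt_two
    (div_neg_of_neg_of_pos (by norm_num) hd0)
  have hab : a ^ (1 - d) = 2 * a := by
    have h := mul_ratio_eq (d := d) 0
    rw [Nat.cast_zero, zero_add] at h
    rw [ha, h, ← Real.rpow_mul zero_le_two]
    congr 1
    field_simp
    ring
  refine ⟨2 * a * G ^ d, by positivity, ?_⟩
  filter_upwards [Ioo_mem_nhdsGT hG] with t ht
  -- Generation `m + 1` is the first one whose gaps `G * a ^ (m + 1)` are shorter than `t`.
  obtain ⟨m, hm1, hm2⟩ := exists_nat_pow_near_of_lt_one (div_pos ht.1 hG)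
    ((div_le_one hG).2 ht.2.le) ha0 ha1
  rw [lt_div_iff₀ hG] at hm1
  rw [div_le_iff₀ hG] at hm2
  let j : Fin ((0 + 2 - 1) * (0 + 2) ^ (m + 1)) → ℕ := fun i => e.symm ⟨0, m + 1, i⟩
  have hj : Function.Injective j := fun i i' h => by simpa using e.symm.injective h
  have hLj : ∀ i, L (j i) = G * a ^ (m + 1) := by
    intro i
    rw [he, Equiv.apply_symm_apply, cantorUnion_eq]
    simp [hGdef, ha]
  have hsub : (⋃ i, Set.Ioc (tailSum L (j i + 1)) (tailSum L (j i))) ⊆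
      Metric.thickening t (stringSet L) := by
    refine Set.iUnion_subset fun i y hy => ?_
    refine Metric.mem_thickening_iff.2 ⟨_, tailSum_mem_stringSet L (j i), ?_⟩
    have h1 := tailSum_eq_add_succ hL.2.2 (j i)
    rw [hLj] at h1
    rw [Real.dist_eq, abs_of_nonpos (by linarith [hy.2])]
    linarith [hy.1]
  refine le_trans ?_ (measure_mono hsub)
  have hdisj : Pairwise (Function.onFun Disjoint
      fun i => Set.Ioc (tailSum L (j i + 1)) (tailSum L (j i))) := fun i i' hii =>
    pairwise_disjoint_Ioc_tailSum hL (hj.ne hii)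
  rw [measure_iUnion hdisj fun _ => measurableSet_Ioc]
  have hvol : ∀ i, volume (Set.Ioc (tailSum L (j i + 1)) (tailSum L (j i))) =
      ENNReal.ofReal (G * a ^ (m + 1)) := by
    intro i
    rw [Real.volume_Ioc, tailSum_eq_add_succ hL.2.2 (j i), hLj]
    congr 1
    ring
  simp only [hvol]
  rw [tsum_fintype, Finset.sum_const, Finset.card_univ, Fintype.card_fin, nsmul_eq_mul,
    ← ENNReal.ofReal_natCast, ← ENNReal.ofReal_mul (by positivity)]
  apply ENNReal.ofReal_le_ofReal
  have h1 : t ^ (1 - d) ≤ (2 * a) ^ m * G ^ (1 - d) := by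
    refine (Real.rpow_le_rpow ht.1.le hm2 (by linarith [hd.2])).trans_eq ?_
    rw [Real.mul_rpow (by positivity) hG.le, ← hab, ← Real.rpow_natCast, ← Real.rpow_natCast,
      ← Real.rpow_mul ha0.le, ← Real.rpow_mul ha0.le, mul_comm (m : ℝ)]
  have h2 : G ^ d * G ^ (1 - d) = G := by
    rw [← Real.rpow_add hG, add_sub_cancel, Real.rpow_one]
  calc 2 * a * G ^ d * t ^ (1 - d) ≤ 2 * a * G ^ d * ((2 * a) ^ m * G ^ (1 - d)) := by gcongr
    _ = (2 * a) ^ (m + 1) * (G ^ d * G ^ (1 - d)) := by ring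
    _ = _ := by
      rw [h2, mul_pow]
      push_cast
      ring

theorem volume_thickening_stringSet_le (n : ℕ) (L : ℕ → ℝ) (t : ℝ) :
    volume (Metric.thickening t (stringSet L)) ≤
      volume (Metric.thickening t (grill (n + 1) (stringSet L))) := by
  rw [← volume_slab (n := n) Metric.isOpen_thickening.measurableSet]
  exact measure_mono fun z hz => (mem_thickening_grill_iff hz.1).2 hz.2

theorem lowerContent_grill_stringSet_ne_zero (n : ℕ) (hd : d ∈ Set.Ioo (0 : ℝ) 1)
    (hL : IsBoundedFractalString L) (hlist : Lists L (cantorUnion d)) {r : ℝ} (hr : r ≤ n + d) :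
    lowerContent (grill (n + 1) (stringSet L)) r ≠ 0 := by
  obtain ⟨c, hc, h⟩ := exists_le_volume_thickening_stringSet hd hL hlist
  suffices ENNReal.ofReal c ≤ lowerContent (grill (n + 1) (stringSet L)) r from
    (lt_of_lt_of_le (ENNReal.ofReal_pos.2 hc) this).ne'
  refine le_liminf_of_le (by isBoundedDefault) ?_
  filter_upwards [h, Ioo_mem_nhdsGT one_pos] with t ht ht1
  unfold tubeRatio
  rw [ENNReal.le_div_iff_mul_le (Or.inl (by simpa using Real.rpow_pos_of_pos ht1.1 _))
    (Or.inl ENNReal.ofReal_ne_top), ← ENNReal.ofReal_mul hc.le]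
  refine le_trans (ENNReal.ofReal_le_ofReal ?_) (ht.trans (volume_thickening_stringSet_le n L t))
  refine mul_le_mul_of_nonneg_left
    (Real.rpow_le_rpow_of_exponent_ge ht1.1 ht1.2.le ?_) hc.le
  push_cast
  linarith

/-- Convergence of the distance zeta integral at every exponent above `D` bounds the volumes of the
neighbourhoods, by Chebyshev's inequality. -/
theorem upperContent_grill_stringSet_eq_zero (n : ℕ) (hd : d ∈ Set.Ioo (0 : ℝ) 1)
    (hL : IsBoundedFractalString L) (hlist : Lists L (cantorUnion d)) {r : ℝ} (hr : n + d < r) :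
    upperContent (grill (n + 1) (stringSet L)) r = 0 := by
  obtain ⟨u, hu1, hu2⟩ := exists_between (lt_min (by linarith : d < r - n) hd.2)
  set A := grill (n + 1) (stringSet L)
  set K := ∫⁻ z in Metric.thickening 1 A, ENNReal.ofReal (Metric.infDist z A) ^ (u - 1)
  have hK : K < ⊤ := lintegral_thickening_grill_lt_top hd hL hlist one_pos
    ⟨hu1, hu2.trans_le (min_le_right _ _)⟩
  have hur : u < r - n := hu2.trans_le (min_le_left _ _)
  have hu1' : u < 1 := hu2.trans_le (min_le_right _ _)
  have hbound : ∀ᶠ t : ℝ in 𝓝[>] 0,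
      tubeRatio A r t ≤ K * ENNReal.ofReal (t ^ (r - n - u)) := by
    filter_upwards [Ioo_mem_nhdsGT one_pos] with t ht
    have hcheb : ENNReal.ofReal t ^ (u - 1) * volume (Metric.thickening t A) ≤ K := by
      rw [← setLIntegral_const]
      refine (setLIntegral_mono' Metric.isOpen_thickening.measurableSet fun z hz => ?_).trans
        (lintegral_mono_set (Metric.thickening_mono ht.2.le A))
      exact ennreal_rpow_anti (by linarith) (ENNReal.ofReal_le_ofReal
        ((Metric.mem_thickening_iff_infDist_lt (grill_stringSet_nonempty n L)).1 hz).le)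
    unfold tubeRatio
    refine ENNReal.div_le_of_le_mul ?_
    have e1 : (r - n - u) + (((n + 1 : ℕ) : ℝ) - r) = -(u - 1) := by push_cast; ring
    have hp : 0 < ENNReal.ofReal t ^ (u - 1) :=
      ENNReal.rpow_pos (ENNReal.ofReal_pos.2 ht.1) ENNReal.ofReal_ne_top
    rw [mul_assoc, ← ENNReal.ofReal_mul (Real.rpow_nonneg ht.1.le _), ← Real.rpow_add ht.1, e1,
      ← ENNReal.ofReal_rpow_of_pos ht.1, ENNReal.rpow_neg, ← div_eq_mul_inv]
    refine (ENNReal.le_div_iff_mul_le (Or.inl hp.ne') (Or.inl ?_)).2 (by rwa [mul_comm])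
    exact ENNReal.rpow_ne_top_of_ne_zero (ENNReal.ofReal_pos.2 ht.1).ne' ENNReal.ofReal_ne_top
  have hlim : Tendsto (fun t : ℝ => K * ENNReal.ofReal (t ^ (r - n - u))) (𝓝[>] 0) (𝓝 0) := by
    have h1 : Tendsto (fun t : ℝ => t ^ (r - n - u)) (𝓝[>] 0) (𝓝 0) := by
      have := (Real.continuousAt_rpow_const 0 (r - n - u) (Or.inr (by linarith))).tendsto
      rw [Real.zero_rpow (by linarith)] at this
      exact this.mono_left nhdsWithin_le_nhds
    have h2 := ENNReal.Tendsto.const_mul (ENNReal.tendsto_ofReal h1) (Or.inr hK.ne)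
    simpa using h2
  exact (tendsto_of_tendsto_of_tendsto_of_le_of_le' tendsto_const_nhds hlim
    (Eventually.of_forall fun _ => zero_le) hbound).limsup_eq

theorem hasBoxDim_grill_stringSet (n : ℕ) (hd : d ∈ Set.Ioo (0 : ℝ) 1)
    (hL : IsBoundedFractalString L) (hlist : Lists L (cantorUnion d)) :
    HasBoxDim (grill (n + 1) (stringSet L)) (n + d) := by
  have hn : (0 : ℝ) ≤ n := Nat.cast_nonneg n
  have hle : ∀ r, lowerContent (grill (n + 1) (stringSet L)) r ≤
      upperContent (grill (n + 1) (stringSet L)) r := fun r => liminf_le_limsup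
  have hup : ∀ r : ℝ, (n : ℝ) + d < r → upperContent (grill (n + 1) (stringSet L)) r = 0 :=
    fun r hr => upperContent_grill_stringSet_eq_zero n hd hL hlist hr
  have hlow : ∀ r : ℝ, lowerContent (grill (n + 1) (stringSet L)) r = 0 → (n : ℝ) + d < r :=
    fun r h => not_le.1 fun hr => lowerContent_grill_stringSet_ne_zero n hd hL hlist hr h
  have hU : {r : ℝ | 0 < r ∧ upperContent (grill (n + 1) (stringSet L)) r = 0} =
      Set.Ioi ((n : ℝ) + d) := by
    ext r
    exact ⟨fun h => hlow r (le_antisymm ((hle r).trans_eq h.2) zero_le),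
      fun h => ⟨lt_trans (by linarith [hd.1]) h, hup r h⟩⟩
  have hLo : {r : ℝ | 0 < r ∧ lowerContent (grill (n + 1) (stringSet L)) r = 0} =
      Set.Ioi ((n : ℝ) + d) := by
    ext r
    exact ⟨fun h => hlow r h.2, fun h => ⟨lt_trans (by linarith [hd.1]) h,
      le_antisymm ((hle r).trans_eq (hup r h)) zero_le⟩⟩
  exact ⟨by rw [upperBoxDim, hU, csInf_Ioi], by rw [lowerBoxDim, hLo, csInf_Ioi]⟩

end Grill

end FractalZeta

theorem mainTheorem10 (N : ℕ) (hN : 1 ≤ N) (D : ℝ) (hD : D ∈ Set.Ioo ((N : ℝ) - 1) (N : ℝ)) :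
    ∃ A : Set (FractalZeta.E N),
      (∃ L : ℕ → ℝ, FractalZeta.IsBoundedFractalString L ∧
        FractalZeta.Lists L (FractalZeta.cantorUnion (D - ((N : ℝ) - 1))) ∧
        A = FractalZeta.grill N (FractalZeta.stringSet L)) ∧
      A.Nonempty ∧ IsCompact A ∧
      FractalZeta.HasBoxDim A D ∧
      FractalZeta.IsMaximallyHyperfractal A := by
  obtain ⟨n, rfl⟩ : ∃ n, N = n + 1 := ⟨N - 1, by omega⟩
  have hd : D - (((n + 1 : ℕ) : ℝ) - 1) ∈ Set.Ioo (0 : ℝ) 1 :=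
    ⟨by linarith [hD.1], by linarith [hD.2]⟩
  obtain ⟨L, hL, hlist⟩ := FractalZeta.exists_string_lists_cantorUnion hd
  refine ⟨_, ⟨L, hL, hlist, rfl⟩, FractalZeta.grill_stringSet_nonempty n L,
    FractalZeta.isCompact_grill (FractalZeta.isCompact_stringSet L), ?_,
    FractalZeta.isMaximallyHyperfractal_grill_stringSet n hd hL hlist⟩
  have h := FractalZeta.hasBoxDim_grill_stringSet n hd hL hlist
  rwa [show (n : ℝ) + (D - (((n + 1 : ℕ) : ℝ) - 1)) = D by push_cast; ring] at h
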